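/- Call a set of closed unit squares in the Euclidean plane \emph{joined along edges} if any two distinct squares of the set are either disjoint, or meet exactly in a common side, or meet exactly in a common corner; call it \emph{connected} if any two of its squares are linked by a chain of squares of the set in which consecutive squares share a side. Such a set $U$ \emph{folds up into the cube} if there is a map $f$ from the region $\bigcup U$ to $\mathbb{R}^3$ that is isometric on each square of $U$ and for which $Q\mapsto f(Q)$ is a bijection from $U$ onto the set of the six faces of the unit cube $[0,1]^3$. An \emph{unfolding of the cube} is a connected set of six unit squares in the plane, joined along edges, that folds up into the cube. \textbf{Theorem.} There are exactly eleven incongruent unfoldings of the cube. That is, there are exactly eleven classes of unfoldings when two unfoldings are identified if some isometry of the plane (reflections allowed) carries the squares of one to the squares of the other; and there are likewise exactly eleven classes when two unfoldings are identified if some isometry of the plane carries the region covered by one onto the region covered by the other. -/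

import Mathlib

namespace CubeUnfolding

/-- The Euclidean plane. -/
abbrev Plane := EuclideanSpace ℝ (Fin 2)

/-- Euclidean three-space. -/
abbrev Space := EuclideanSpace ℝ (Fin 3)

/-- The square `[0,1] × [0,1]`. -/
def stdSquare : Set Plane := {p | ∀ i, p i ∈ Set.Icc (0 : ℝ) 1}

/-- The side `[0,1] × {0}` of the standard square. -/
def stdSide : Set Plane := {p | p ∈ stdSquare ∧ p 1 = 0}

/-- `Q` is a (closed, filled) unit square, in any position in the plane. -/
def IsUnitSquare (Q : Set Plane) : Prop :=
  ∃ e : Plane ≃ᵢ Plane, e '' stdSquare = Q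

/-- `S` is one of the four sides of the unit square `Q`. As `e` may be composed with the
symmetries of the standard square, all four sides arise. -/
def IsSide (S Q : Set Plane) : Prop :=
  ∃ e : Plane ≃ᵢ Plane, e '' stdSquare = Q ∧ e '' stdSide = S

/-- `v` is one of the four corners of the unit square `Q`. -/
def IsCorner (v : Plane) (Q : Set Plane) : Prop :=
  ∃ e : Plane ≃ᵢ Plane, e '' stdSquare = Q ∧ e 0 = v

/-- The intersection of `Q` and `R` is a full side of both. -/
def ShareSide (Q R : Set Plane) : Prop :=
  IsSide (Q ∩ R) Q ∧ IsSide (Q ∩ R) R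

/-- The intersection of `Q` and `R` is a single point, a corner of both. -/
def ShareCorner (Q R : Set Plane) : Prop :=
  ∃ v, Q ∩ R = {v} ∧ IsCorner v Q ∧ IsCorner v R

/-- A collection of squares is joined along edges: two distinct squares that meet
do so in a common side or in a common corner (so there is no overlap and no partial contact
of sides). -/
def JoinedAlongEdges (U : Set (Set Plane)) : Prop :=
  ∀ Q ∈ U, ∀ R ∈ U, Q ≠ R → Q ∩ R = ∅ ∨ ShareSide Q R ∨ ShareCorner Q R

/-- Any two squares of the collection are linked by a chain of squares of the collection in
which consecutive squares share a side. -/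
def EdgeConnected (U : Set (Set Plane)) : Prop :=
  ∀ Q ∈ U, ∀ R ∈ U,
    Relation.ReflTransGen (fun A B => A ∈ U ∧ B ∈ U ∧ ShareSide A B) Q R

/-- The solid unit cube `[0,1]³`. -/
def solidCube : Set Space := {x | ∀ i, x i ∈ Set.Icc (0 : ℝ) 1}

/-- The set of the six faces of the unit cube. -/
def cubeFaces : Set (Set Space) :=
  {F | ∃ i : Fin 3, ∃ c : ℝ, (c = 0 ∨ c = 1) ∧ F = {x | x ∈ solidCube ∧ x i = c}}

/-- The collection folds up into the cube: a single map defined on the whole region covered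
by the squares (its values elsewhere are irrelevant) is isometric on each square and carries the
squares bijectively onto the faces of the cube. For a finite collection of closed squares such a
map is automatically continuous on the region, so squares stay attached wherever they touch. -/
def FoldsUpIntoCube (U : Set (Set Plane)) : Prop :=
  ∃ f : Plane → Space,
    (∀ Q ∈ U, ∀ x ∈ Q, ∀ y ∈ Q, dist (f x) (f y) = dist x y) ∧
    Set.BijOn (fun Q => f '' Q) U cubeFaces

/-- An unfolding of the cube: a connected plane arrangement of six unit squares, joined along
edges, that folds up into the cube. -/
structure IsUnfolding (U : Set (Set Plane)) : Prop where
  card : U.ncard = 6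
  squares : ∀ Q ∈ U, IsUnitSquare Q
  joined : JoinedAlongEdges U
  connected : EdgeConnected U
  folds : FoldsUpIntoCube U

/-- The type of all unfoldings of the cube. -/
abbrev Unfolding := {U : Set (Set Plane) // IsUnfolding U}

/-- The plane region covered by an unfolding. -/
def Unfolding.region (U : Unfolding) : Set Plane := ⋃₀ U.1

/-- Congruence of arrangements: an isometry of the plane (reflections allowed) carries the
squares of one to the squares of the other. -/
def congruence : Setoid Unfolding where
  r U V := ∃ g : Plane ≃ᵢ Plane, (fun Q => g '' Q) '' U.1 = V.1
  iseqv :=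
    { refl := fun U => ⟨IsometryEquiv.refl _, by
        change (fun Q => id '' Q) '' U.1 = U.1
        simp⟩
      symm := by
        rintro U V ⟨g, h⟩
        refine ⟨g.symm, ?_⟩
        rw [← h]
        simp [Set.image_image]
      trans := by
        rintro U V W ⟨g, h⟩ ⟨k, h'⟩
        refine ⟨g.trans k, ?_⟩
        rw [← h', ← h]
        simp only [Set.image_image]
        rfl }

/-- Congruence of shapes: an isometry of the plane (reflections allowed) carries the region
covered by one arrangement onto the region covered by the other. -/
def shapeCongruence : Setoid Unfolding where
  r U V := ∃ g : Plane ≃ᵢ Plane, g '' U.region = V.region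
  iseqv :=
    { refl := fun U => ⟨IsometryEquiv.refl _, Set.image_id _⟩
      symm := by
        rintro U V ⟨g, h⟩
        refine ⟨g.symm, ?_⟩
        rw [← h]
        simp [Set.image_image]
      trans := by
        rintro U V W ⟨g, h⟩ ⟨k, h'⟩
        refine ⟨g.trans k, ?_⟩
        rw [← h', ← h]
        simp only [Set.image_image]
        rfl }

end CubeUnfolding

/-! A unit square sharing a full side with a lattice cell is itself a lattice cell. So an unfolding
with one square moved to a cell lies wholly in the lattice (`ShareSide.exists_eq_cell`,
`IsUnfolding.exists_cells`), and a further translation makes its lexicographically least cell the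
origin.

Folding is rigid. A symmetry of the cube lays the first square flat on the bottom face
(`exists_cubeSym_eqOn_flat`). Across a common side the neighbour must go to the other face through
that edge, in a unique way (`hinge`, `CubeFrame.eqOn_place_roll`). Folding is therefore rolling a
cube over the cells. It is recorded by frames whose third entry, the inward normal, names the face
covered. Growing an unfolding cell by cell without repeating a face puts it among the finitely many
lists of `partialNets 5` (`IsUnfolding.exists_partialNet`), and a finite check finds one of eleven
nets inside each list, up to a lattice isometry. Conversely, the eleven nets do fold: the placements
of their cells agree wherever cells meet (`netWords_compatible`).

The nets are inequivalent even as regions. Within distance 1 of the origin a normalized region lies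
in the first quadrant. An isometry carrying this corner into another union of cells must take it to
a lattice point and the axes to lattice directions (`exists_eq_latIso_of_image_region`). It thus
permutes lattice cells, and `spread`, which lattice isometries preserve, separates the nets. Since
congruence of arrangements implies congruence of regions, both counts are eleven. -/

namespace CubeUnfolding

/-! ### Lattice nets and the rolling cube -/

/-- The step to the neighbouring cell: right, left, up, down. -/
def step : Fin 4 → ℤ × ℤ
  | 0 => (1, 0)
  | 1 => (-1, 0)
  | 2 => (0, 1)
  | 3 => (0, -1)

/-- A frame records the images of the three coordinate directions under a symmetry of the cube;
`±1, ±2, ±3` stand for the signed coordinate directions of space. -/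
abbrev Frame := ℤ × ℤ × ℤ

/-- The change of frame when the folding passes to a neighbouring cell. -/
def roll : Fin 4 → Frame → Frame
  | 0, (u, v, w) => (w, v, -u)
  | 1, (u, v, w) => (-w, v, u)
  | 2, (u, v, w) => (u, w, -v)
  | 3, (u, v, w) => (u, -w, v)

/-- The cell reached from the origin by a word of steps, the last step being the head. -/
def endCell : List (Fin 4) → ℤ × ℤ
  | [] => (0, 0)
  | d :: l => endCell l + step d

/-- The frame reached from the standard frame by rolling along a word of steps. -/
def endFrame : List (Fin 4) → Frame
  | [] => (1, 2, 3)
  | d :: l => roll d (endFrame l)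

/-- The eleven nets, each as a list of words leading from its first cell to its cells. -/
def netWords : Fin 11 → List (List (Fin 4)) := ![
  [[], [0], [2], [3, 0], [2, 2], [3, 3, 0]],
  [[], [2], [0, 2], [2, 2], [0, 0, 2], [0, 0, 0, 2]],
  [[], [0], [2], [3, 0], [3, 3, 0], [0, 3, 3, 0]],
  [[], [0], [2], [3, 0], [0, 3, 0], [3, 3, 0]],
  [[], [0], [2], [0, 0], [3, 0], [3, 3, 0]],
  [[], [0], [2], [3, 0], [0, 3, 0], [3, 0, 3, 0]],
  [[], [0], [2], [0, 0], [3, 0], [0, 0, 0]],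
  [[], [0], [2], [0, 0], [0, 0, 0], [3, 0, 0]],
  [[], [0], [2], [0, 0], [0, 0, 0], [3, 0, 0, 0]],
  [[], [0], [2, 0], [3, 0], [0, 3, 0], [3, 3, 0]],
  [[], [0], [0, 0], [2, 0], [3, 0], [3, 3, 0]]]

/-- The cells of the eleven nets. -/
def netCells : Fin 11 → List (ℤ × ℤ) := ![
  [(0, 0), (1, 0), (0, 1), (1, -1), (0, 2), (1, -2)],
  [(0, 0), (0, 1), (1, 1), (0, 2), (2, 1), (3, 1)],
  [(0, 0), (1, 0), (0, 1), (1, -1), (1, -2), (2, -2)],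
  [(0, 0), (1, 0), (0, 1), (1, -1), (2, -1), (1, -2)],
  [(0, 0), (1, 0), (0, 1), (2, 0), (1, -1), (1, -2)],
  [(0, 0), (1, 0), (0, 1), (1, -1), (2, -1), (2, -2)],
  [(0, 0), (1, 0), (0, 1), (2, 0), (1, -1), (3, 0)],
  [(0, 0), (1, 0), (0, 1), (2, 0), (3, 0), (2, -1)],
  [(0, 0), (1, 0), (0, 1), (2, 0), (3, 0), (3, -1)],
  [(0, 0), (1, 0), (1, 1), (1, -1), (2, -1), (1, -2)],
  [(0, 0), (1, 0), (2, 0), (1, 1), (1, -1), (1, -2)]]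

/-- The cells alone suffice for questions of congruence; the words also carry the paths needed for
connectedness and folding. -/
theorem netCells_eq : ∀ a, netCells a = (netWords a).map endCell := by
  decide

/-- The sign attached to a Boolean. -/
def sgn (b : Bool) : ℤ := if b then -1 else 1

/-- The action of a lattice isometry on cells. -/
def act (w : Bool × Bool × Bool) (t c : ℤ × ℤ) : ℤ × ℤ :=
  (sgn w.2.1 * (if w.1 then c.2 else c.1) + t.1, sgn w.2.2 * (if w.1 then c.1 else c.2) + t.2)

/-- The cells that are lexicographically at least the origin. -/
def LexNonneg (c : ℤ × ℤ) : Prop := 0 < c.1 ∨ c.1 = 0 ∧ 0 ≤ c.2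

instance : DecidablePred LexNonneg := fun _ => inferInstanceAs (Decidable (_ ∨ _))

/-- An order used to normalize lists of cells. -/
def entryLE (x y : (ℤ × ℤ) × Frame) : Prop :=
  x.1.1 < y.1.1 ∨ x.1.1 = y.1.1 ∧ x.1.2 ≤ y.1.2

instance : DecidableRel entryLE := fun _ _ => inferInstanceAs (Decidable (_ ∨ _))

/-- The one-cell extensions of a partial net in which no face of the cube is used twice. -/
def extensions (L : List ((ℤ × ℤ) × Frame)) : List (List ((ℤ × ℤ) × Frame)) :=
  L.flatMap fun x => [0, 1, 2, 3].flatMap fun d =>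
    if LexNonneg (x.1 + step d) ∧
        ∀ z ∈ L, z.2.2.2 ≠ (roll d x.2).2.2 then
      [L.orderedInsert entryLE (x.1 + step d, roll d x.2)]
    else []

/-- The partial nets with `k + 1` cells. -/
def partialNets : ℕ → List (List ((ℤ × ℤ) × Frame))
  | 0 => [[((0, 0), (1, 2, 3))]]
  | k + 1 => (partialNets k).dedup.flatMap extensions

/-- All linear parts of lattice isometries. -/
def linearParts : List (Bool × Bool × Bool) :=
  [(false, false, false), (false, false, true), (false, true, false), (false, true, true),
   (true, false, false), (true, false, true), (true, true, false), (true, true, true)]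

/-- The sum of the fourth powers of all mutual distances of the cells. -/
def spread (L : List (ℤ × ℤ)) : ℤ :=
  (L.map fun c => (L.map fun c' => ((c.1 - c'.1) ^ 2 + (c.2 - c'.2) ^ 2) ^ 2).sum).sum

theorem spread_netCells_injective : Function.Injective fun a => spread (netCells a) := by
  decide +kernel

/-- Every partial net with six cells is congruent to one of the nets; comparing spreads first
only shortens the search. -/
theorem exists_act_of_mem_partialNets : ∀ L ∈ partialNets 5, ∃ a : Fin 11,
    spread (L.map Prod.fst) = spread (netCells a) ∧ ∃ w ∈ linearParts,
    ∃ t ∈ L.map Prod.fst, ∀ c ∈ netCells a, act w t c ∈ L.map Prod.fst := by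
  decide +kernel

/-! ### Isometries permuting and reflecting the coordinates -/

theorem sgn_mul_self (b : Bool) : sgn b * sgn b = 1 := by cases b <;> rfl

theorem sgn_mul_self_real (b : Bool) : (sgn b : ℝ) * sgn b = 1 := by
  exact_mod_cast congrArg (Int.cast : ℤ → ℝ) (sgn_mul_self b)

/-- The isometry of Euclidean space that permutes the coordinates, reflects some of them about
`1/2`, and translates. -/
noncomputable def sgnIso {n : ℕ} (σ : Equiv.Perm (Fin n)) (b : Fin n → Bool) (t : Fin n → ℝ) :
    EuclideanSpace ℝ (Fin n) ≃ᵢ EuclideanSpace ℝ (Fin n) where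
  toFun x := WithLp.toLp 2 fun i => (sgn (b i) : ℝ) * (x (σ i) - 1 / 2) + 1 / 2 + t i
  invFun y := WithLp.toLp 2 fun i =>
    (sgn (b (σ⁻¹ i)) : ℝ) * (y (σ⁻¹ i) - 1 / 2 - t (σ⁻¹ i)) + 1 / 2
  left_inv x := by
    ext i
    have h := sgn_mul_self_real (b (σ⁻¹ i))
    have hi : σ (σ⁻¹ i) = i := by simp
    simp only [hi]
    linear_combination (x i - 1 / 2) * h
  right_inv y := by
    ext i
    have h := sgn_mul_self_real (b i)
    have hi : σ⁻¹ (σ i) = i := by simp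
    simp only [hi]
    linear_combination (y i - 1 / 2 - t i) * h
  isometry_toFun := by
    refine Isometry.of_dist_eq fun x y => ?_
    simp only [EuclideanSpace.dist_eq, Real.dist_eq, sq_abs]
    congr 1
    rw [← Equiv.sum_comp σ fun i => (x i - y i) ^ 2]
    refine Finset.sum_congr rfl fun i _ => ?_
    linear_combination (x (σ i) - y (σ i)) ^ 2 * sgn_mul_self_real (b i)

@[simp] theorem sgnIso_apply {n : ℕ} (σ : Equiv.Perm (Fin n)) (b : Fin n → Bool) (t : Fin n → ℝ)
    (x : EuclideanSpace ℝ (Fin n)) (i : Fin n) :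
    sgnIso σ b t x i = (sgn (b i) : ℝ) * (x (σ i) - 1 / 2) + 1 / 2 + t i := rfl

/-- The axis-parallel unit box with least vertex `c`. -/
def box {n : ℕ} (c : Fin n → ℝ) : Set (EuclideanSpace ℝ (Fin n)) :=
  {x | ∀ i, x i ∈ Set.Icc (c i) (c i + 1)}

theorem solidCube_eq_box : solidCube = box 0 := by
  simp [solidCube, box]

/-- Reflection about `1/2` turns `[c, c + 1]` into `[-c, -c + 1]`, so least vertices transform
without a correction term. -/
theorem sgnIso_mem_box {n : ℕ} (σ : Equiv.Perm (Fin n)) (b : Fin n → Bool) (t c : Fin n → ℝ)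
    (x : EuclideanSpace ℝ (Fin n)) :
    sgnIso σ b t x ∈ box (fun i => (sgn (b i) : ℝ) * c (σ i) + t i) ↔ x ∈ box c := by
  simp only [box, Set.mem_ofPred_eq]
  rw [← σ.forall_congr_right (q := fun i => x i ∈ Set.Icc (c i) (c i + 1))]
  refine forall_congr' fun i => ?_
  rw [sgnIso_apply, Set.mem_Icc, Set.mem_Icc]
  cases b i <;> simp only [sgn, Bool.false_eq_true, if_true, if_false] <;> push_cast <;>
    constructor <;> rintro ⟨h1, h2⟩ <;> constructor <;> linarith

theorem sgnIso_image_box {n : ℕ} (σ : Equiv.Perm (Fin n)) (b : Fin n → Bool) (t c : Fin n → ℝ) :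
    sgnIso σ b t '' box c = box (fun i => (sgn (b i) : ℝ) * c (σ i) + t i) := by
  ext y
  obtain ⟨x, rfl⟩ := (sgnIso σ b t).surjective y
  rw [(sgnIso σ b t).injective.mem_set_image, sgnIso_mem_box]

theorem sgnIso_symm {n : ℕ} (σ : Equiv.Perm (Fin n)) (b : Fin n → Bool) :
    (sgnIso σ b 0).symm = sgnIso σ⁻¹ (fun i => b (σ⁻¹ i)) 0 := by
  ext y i
  simp [sgnIso, IsometryEquiv.symm]

/-! ### Symmetries of the cube -/

/-- An isometry of space that permutes the faces of the cube. -/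
def CubeSym (T : Space ≃ᵢ Space) : Prop :=
  (∀ F ∈ cubeFaces, T '' F ∈ cubeFaces) ∧ ∀ F ∈ cubeFaces, T.symm '' F ∈ cubeFaces

theorem CubeSym.symm {T : Space ≃ᵢ Space} (h : CubeSym T) : CubeSym T.symm :=
  ⟨h.2, h.1⟩

theorem CubeSym.trans {T T' : Space ≃ᵢ Space} (h : CubeSym T) (h' : CubeSym T') :
    CubeSym (T.trans T') := by
  refine ⟨fun F hF => ?_, fun F hF => ?_⟩
  · change (T' ∘ T) '' F ∈ _
    rw [Set.image_comp]
    exact h'.1 _ (h.1 F hF)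
  · change (T.symm ∘ T'.symm) '' F ∈ _
    rw [Set.image_comp]
    exact h.2 _ (h'.2 F hF)

theorem cubeSym_refl : CubeSym (IsometryEquiv.refl Space) :=
  ⟨fun F hF => (Set.image_id F).symm ▸ hF, fun F hF => (Set.image_id F).symm ▸ hF⟩

theorem sgnIso_preimage_face (σ : Equiv.Perm (Fin 3)) (b : Fin 3 → Bool) {F : Set Space}
    (hF : F ∈ cubeFaces) : sgnIso σ b 0 ⁻¹' F ∈ cubeFaces := by
  obtain ⟨i, c, hc, rfl⟩ := hF
  -- A sign is its own inverse, so this level solves the pulled-back equation of the face for the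
  -- coordinate `σ i`.
  refine ⟨σ i, (sgn (b i) : ℝ) * (c - 1 / 2) + 1 / 2, ?_, ?_⟩
  · rcases hc with rfl | rfl <;> cases b i <;> norm_num [sgn]
  · ext x
    have h := sgnIso_mem_box σ b 0 0 x
    simp only [Pi.zero_apply, mul_zero, add_zero] at h
    change (_ ∈ solidCube ∧ _) ↔ (x ∈ solidCube ∧ _)
    rw [solidCube_eq_box]
    refine and_congr h ?_
    rw [sgnIso_apply]
    cases b i <;> simp only [sgn, Bool.false_eq_true, if_true, if_false, Pi.zero_apply] <;>
      push_cast <;> constructor <;> intro h <;> linarith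

theorem cubeSym_sgnIso (σ : Equiv.Perm (Fin 3)) (b : Fin 3 → Bool) : CubeSym (sgnIso σ b 0) := by
  refine ⟨fun F hF => ?_, fun F hF => ?_⟩
  · rw [← IsometryEquiv.preimage_symm, sgnIso_symm]
    exact sgnIso_preimage_face _ _ hF
  · rw [IsometryEquiv.image_symm]
    exact sgnIso_preimage_face _ _ hF

/-! ### Isometric maps on squares are determined by three corners -/

/-- By polarization, inner products of differences from `f p` equal those in the plane. Hence `f x`
has the same coordinates relative to the images of the two unit vectors at `p` as `x` has relative
to the vectors themselves. The signs `s` and `t` let `p` be any corner of a square. -/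
theorem eqOn_of_isometric {E : Type*} [NormedAddCommGroup E] [InnerProductSpace ℝ E]
    {S : Set Plane} {f g : Plane → E}
    (hf : ∀ x ∈ S, ∀ y ∈ S, dist (f x) (f y) = dist x y)
    (hg : ∀ x ∈ S, ∀ y ∈ S, dist (g x) (g y) = dist x y)
    {p : Plane} {s t : ℝ} (hs : s ^ 2 = 1) (ht : t ^ 2 = 1)
    (hp : p ∈ S) (hps : p + !₂[s, 0] ∈ S) (hpt : p + !₂[0, t] ∈ S)
    (h0 : f p = g p) (h1 : f (p + !₂[s, 0]) = g (p + !₂[s, 0]))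
    (h2 : f (p + !₂[0, t]) = g (p + !₂[0, t])) : Set.EqOn f g S := by
  have key : ∀ f : Plane → E, (∀ x ∈ S, ∀ y ∈ S, dist (f x) (f y) = dist x y) → ∀ x ∈ S,
      f x = f p + (s * (x 0 - p 0)) • (f (p + !₂[s, 0]) - f p)
        + (t * (x 1 - p 1)) • (f (p + !₂[0, t]) - f p) := by
    intro f hf x hx
    have hin : ∀ y ∈ S, ∀ z ∈ S, inner ℝ (f y - f p) (f z - f p) = inner ℝ (y - p) (z - p) := by
      intro y hy z hz
      have e1 := hf y hy p hp
      have e2 := hf z hz p hp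
      have e3 := hf y hy z hz
      rw [dist_eq_norm, dist_eq_norm] at e1 e2 e3
      rw [real_inner_eq_norm_mul_self_add_norm_mul_self_sub_norm_sub_mul_self_div_two,
        real_inner_eq_norm_mul_self_add_norm_mul_self_sub_norm_sub_mul_self_div_two,
        sub_sub_sub_cancel_right, sub_sub_sub_cancel_right, e1, e2, e3]
    have i1 := hin x hx x hx
    have i2 := hin x hx _ hps
    have i3 := hin x hx _ hpt
    have i4 := hin _ hps _ hps
    have i5 := hin _ hpt _ hpt
    have i6 := hin _ hps _ hpt
    simp only [add_sub_cancel_left, PiLp.inner_apply, Fin.sum_univ_two, PiLp.sub_apply]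
      at i1 i2 i3 i4 i5 i6
    rw [← sub_eq_zero, ← sub_sub, ← sub_sub]
    generalize f (p + !₂[s, 0]) - f p = a at *
    generalize f (p + !₂[0, t]) - f p = b at *
    generalize f x - f p = z at *
    simp at i1 i2 i3 i4 i5 i6
    -- The squared norm of the difference between the two sides expands into known inner products,
    -- which cancel.
    rw [← norm_eq_zero, ← sq_eq_zero_iff, norm_sub_sq_real, norm_sub_sq_real, inner_sub_left]
    simp only [real_inner_smul_left, real_inner_smul_right, norm_smul, mul_pow, Real.norm_eq_abs,
      sq_abs, i1, i2, i3, i4, i5, i6, hs, ht]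
    ring_nf
    simp only [hs, ht]
    ring
  intro x hx
  rw [key f hf x hx, key g hg x hx, h0, h1, h2]

/-! ### Lattice cells and lattice isometries of the plane -/

/-- The lattice square with lower left corner `c`. -/
def cell (c : ℤ × ℤ) : Set Plane := box ![(c.1 : ℝ), (c.2 : ℝ)]

theorem mem_cell {c : ℤ × ℤ} {p : Plane} :
    p ∈ cell c ↔ (c.1 ≤ p 0 ∧ p 0 ≤ c.1 + 1) ∧ (c.2 ≤ p 1 ∧ p 1 ≤ c.2 + 1) := by
  simp [cell, box, Fin.forall_fin_two]

theorem cell_zero : cell (0, 0) = stdSquare := by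
  ext p
  simp [mem_cell, stdSquare, Fin.forall_fin_two]

/-- The lattice isometry of the plane acting on cells by `act w t`. -/
noncomputable def latIso (w : Bool × Bool × Bool) (t : ℤ × ℤ) : Plane ≃ᵢ Plane :=
  sgnIso (if w.1 then Equiv.swap 0 1 else 1) ![w.2.1, w.2.2] ![(t.1 : ℝ), (t.2 : ℝ)]

theorem latIso_apply (w : Bool × Bool × Bool) (t : ℤ × ℤ) (p : Plane) :
    latIso w t p = !₂[(sgn w.2.1 : ℝ) * ((if w.1 then p 1 else p 0) - 1 / 2) + 1 / 2 + t.1,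
      (sgn w.2.2 : ℝ) * ((if w.1 then p 0 else p 1) - 1 / 2) + 1 / 2 + t.2] := by
  obtain ⟨s, a, b⟩ := w
  ext i
  fin_cases i <;> cases s <;> simp [latIso]

theorem latIso_image_cell (w : Bool × Bool × Bool) (t c : ℤ × ℤ) :
    latIso w t '' cell c = cell (act w t c) := by
  rw [latIso, cell, sgnIso_image_box, cell]
  congr 1
  obtain ⟨s, a, b⟩ := w
  ext i
  fin_cases i <;> cases s <;> simp [act]

/-- The centre of a cell lies in no other lattice cell, so a region determines its cells. -/
theorem cell_subset_sUnion_iff {C : Set (ℤ × ℤ)} {c : ℤ × ℤ} :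
    cell c ⊆ ⋃₀ (cell '' C) ↔ c ∈ C := by
  refine ⟨fun h => ?_, fun h => Set.subset_sUnion_of_mem ⟨c, h, rfl⟩⟩
  have hm : (!₂[(c.1 : ℝ) + 1 / 2, c.2 + 1 / 2] : Plane) ∈ cell c := by
    rw [mem_cell]; simp; norm_num
  obtain ⟨_, ⟨c', hc', rfl⟩, hm'⟩ := h hm
  rw [mem_cell] at hm'
  simp only [Matrix.cons_val_zero, Matrix.cons_val_one] at hm'
  obtain ⟨⟨h1, h2⟩, h3, h4⟩ := hm'
  have g1 : c'.1 < c.1 + 1 := by exact_mod_cast (by linarith : (c'.1 : ℝ) < c.1 + 1)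
  have g2 : c.1 < c'.1 + 1 := by exact_mod_cast (by linarith : (c.1 : ℝ) < c'.1 + 1)
  have g3 : c'.2 < c.2 + 1 := by exact_mod_cast (by linarith : (c'.2 : ℝ) < c.2 + 1)
  have g4 : c.2 < c'.2 + 1 := by exact_mod_cast (by linarith : (c.2 : ℝ) < c'.2 + 1)
  have : c = c' := Prod.ext (by omega) (by omega)
  exact this ▸ hc'

theorem cell_injective : Function.Injective cell := by
  intro c c' h
  have := cell_subset_sUnion_iff (C := {c'}) (c := c)
  simp only [Set.image_singleton, Set.sUnion_singleton, Set.mem_singleton_iff] at this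
  exact this.1 h.le

theorem isUnitSquare_cell (c : ℤ × ℤ) : IsUnitSquare (cell c) := by
  refine ⟨latIso (false, false, false) c, ?_⟩
  rw [← cell_zero, latIso_image_cell]
  simp [act, sgn]

/-- A point with integer coordinates. -/
def IsLatticePoint (p : Plane) : Prop := ∃ m : ℤ × ℤ, p = !₂[(m.1 : ℝ), (m.2 : ℝ)]

theorem dist_sq_plane (p q : Plane) : dist p q ^ 2 = (p 0 - q 0) ^ 2 + (p 1 - q 1) ^ 2 := by
  rw [EuclideanSpace.dist_eq, Real.sq_sqrt (by positivity)]
  simp [Fin.sum_univ_two, Real.dist_eq]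

theorem dist_sq_space (p q : Space) :
    dist p q ^ 2 = (p 0 - q 0) ^ 2 + (p 1 - q 1) ^ 2 + (p 2 - q 2) ^ 2 := by
  rw [EuclideanSpace.dist_eq, Real.sq_sqrt (by positivity)]
  simp [Fin.sum_univ_three, Real.dist_eq]

/-- An integral vector of length 1 is a signed basis vector. The image of the other basis vector is
orthogonal to it, hence also signed basis, and three points determine a plane isometry. -/
theorem exists_eq_latIso {e : Plane ≃ᵢ Plane} (h0 : IsLatticePoint (e 0))
    (h1 : IsLatticePoint (e !₂[1, 0])) : ∃ w t, e = latIso w t := by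
  obtain ⟨m, hm⟩ := h0
  obtain ⟨n, hn⟩ := h1
  have d1 : dist (e !₂[1, 0]) (e 0) ^ 2 = 1 := by
    rw [e.isometry.dist_eq, dist_sq_plane]; simp
  have d2 : dist (e !₂[0, 1]) (e 0) ^ 2 = 1 := by
    rw [e.isometry.dist_eq, dist_sq_plane]; simp
  have d3 : dist (e !₂[0, 1]) (e !₂[1, 0]) ^ 2 = 2 := by
    rw [e.isometry.dist_eq, dist_sq_plane]; simp; norm_num
  rw [hm, hn, dist_sq_plane] at d1
  rw [hm, dist_sq_plane] at d2
  rw [hn, dist_sq_plane] at d3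
  simp only [Matrix.cons_val_zero, Matrix.cons_val_one] at d1 d2 d3
  obtain ⟨a, ha⟩ : ∃ a, a = n.1 - m.1 := ⟨_, rfl⟩
  obtain ⟨b, hb⟩ : ∃ b, b = n.2 - m.2 := ⟨_, rfl⟩
  have hn1 : (n.1 : ℝ) = m.1 + a := by rw [ha]; push_cast; ring
  have hn2 : (n.2 : ℝ) = m.2 + b := by rw [hb]; push_cast; ring
  rw [hn1, hn2] at d1 d3 hn
  have dab : a ^ 2 + b ^ 2 = 1 := by
    have : (a : ℝ) ^ 2 + (b : ℝ) ^ 2 = 1 := by linear_combination d1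
    exact_mod_cast this
  have hx : (a : ℝ) * (e !₂[0, 1] 0 - m.1) + b * (e !₂[0, 1] 1 - m.2) = 0 := by
    linear_combination (d1 + d2 - d3) / 2
  obtain ⟨x, hx'⟩ : ∃ x, x = e !₂[0, 1] 0 - m.1 := ⟨_, rfl⟩
  obtain ⟨y, hy'⟩ : ∃ y, y = e !₂[0, 1] 1 - m.2 := ⟨_, rfl⟩
  rw [← hx', ← hy'] at hx d2
  have e2 : e !₂[0, 1] = !₂[m.1 + x, m.2 + y] := by
    ext i; fin_cases i <;> simp [hx', hy']
  have hw : ∃ s f g : Bool, a = (if s then 0 else sgn f) ∧ b = (if s then sgn g else 0) ∧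
      x = ((if s then sgn f else 0 : ℤ) : ℝ) ∧ y = ((if s then 0 else sgn g : ℤ) : ℝ) := by
    have ha2 : a ≤ 1 := by nlinarith
    have ha1 : -1 ≤ a := by nlinarith
    have hb2 : b ≤ 1 := by nlinarith
    have hb1 : -1 ≤ b := by nlinarith
    have hcase : (a = 1 ∨ a = -1) ∧ b = 0 ∨ a = 0 ∧ (b = 1 ∨ b = -1) := by
      clear hx e2 hn hn1 hn2 ha hb d1 d3
      interval_cases a <;> interval_cases b <;> omega
    rcases hcase with ⟨ha, rfl⟩ | ⟨rfl, hb⟩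
    · have hx0 : x = 0 := by rcases ha with rfl | rfl <;> simpa using hx
      have hy : y = 1 ∨ y = -1 := by
        rw [hx0] at d2; exact sq_eq_one_iff.mp (by linarith)
      rcases ha with rfl | rfl <;> rcases hy with rfl | rfl
      · exact ⟨false, false, false, by simp [sgn, hx0]⟩
      · exact ⟨false, false, true, by simp [sgn, hx0]⟩
      · exact ⟨false, true, false, by simp [sgn, hx0]⟩
      · exact ⟨false, true, true, by simp [sgn, hx0]⟩
    · have hy0 : y = 0 := by rcases hb with rfl | rfl <;> simpa using hx
      have hx1 : x = 1 ∨ x = -1 := by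
        rw [hy0] at d2; exact sq_eq_one_iff.mp (by linarith)
      rcases hb with rfl | rfl <;> rcases hx1 with rfl | rfl
      · exact ⟨true, false, false, by simp [sgn, hy0]⟩
      · exact ⟨true, true, false, by simp [sgn, hy0]⟩
      · exact ⟨true, false, true, by simp [sgn, hy0]⟩
      · exact ⟨true, true, true, by simp [sgn, hy0]⟩
  obtain ⟨s, f, g, rfl, rfl, rfl, rfl⟩ := hw
  -- A reflection about `1/2` sends 0 to 1, so each reflected coordinate needs its translation
  -- lowered by 1.
  refine ⟨(s, f, g), (m.1 - (if f then 1 else 0), m.2 - (if g then 1 else 0)), ?_⟩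
  apply IsometryEquiv.ext
  intro p
  have z1 : (0 : Plane) + !₂[1, 0] = !₂[1, 0] := zero_add _
  have z2 : (0 : Plane) + !₂[0, 1] = !₂[0, 1] := zero_add _
  refine eqOn_of_isometric (S := Set.univ) (fun x _ y _ => e.isometry.dist_eq x y)
    (fun x _ y _ => (latIso _ _).isometry.dist_eq x y) (p := 0) (s := 1) (t := 1) (by norm_num)
    (by norm_num) trivial trivial trivial ?_ ?_ ?_ (Set.mem_univ p)
  · rw [hm, latIso_apply]
    cases s <;> cases f <;> cases g <;> (ext i; fin_cases i <;> simp [sgn] <;> ring)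
  · rw [z1, hn, latIso_apply]
    cases s <;> cases f <;> cases g <;> (ext i; fin_cases i <;> simp [sgn] <;> ring)
  · rw [z2, e2, latIso_apply]
    cases s <;> cases f <;> cases g <;> (ext i; fin_cases i <;> simp [sgn] <;> ring)

/-! ### Squares joined along edges -/

/-- Points of a unit square at distance `√2` are opposite corners. -/
theorem isLatticePoint_of_dist_sq {c : ℤ × ℤ} {p q : Plane} (hp : p ∈ cell c) (hq : q ∈ cell c)
    (h : dist p q ^ 2 = 2) : IsLatticePoint p := by
  rw [mem_cell] at hp hq
  rw [dist_sq_plane] at h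
  obtain ⟨⟨h1, h2⟩, h3, h4⟩ := hp
  obtain ⟨⟨g1, g2⟩, g3, g4⟩ := hq
  have key : ∀ {a x y : ℝ}, a ≤ x → x ≤ a + 1 → a ≤ y → y ≤ a + 1 →
      (x - y) ^ 2 ≤ 1 ∧ ((x - y) ^ 2 = 1 → x = a ∨ x = a + 1) := by
    intro a x y h1 h2 h3 h4
    refine ⟨by nlinarith, fun h => ?_⟩
    rcases sq_eq_one_iff.mp h with h | h
    · exact Or.inr (by linarith)
    · exact Or.inl (by linarith)
  have k1 := key h1 h2 g1 g2
  have k2 := key h3 h4 g3 g4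
  have r1 : ∃ m : ℤ, p 0 = m := by
    rcases k1.2 (by linarith [k1.1, k2.1]) with h | h
    · exact ⟨c.1, h⟩
    · exact ⟨c.1 + 1, by rw [h]; push_cast; rfl⟩
  have r2 : ∃ m : ℤ, p 1 = m := by
    rcases k2.2 (by linarith [k1.1, k2.1]) with h | h
    · exact ⟨c.2, h⟩
    · exact ⟨c.2 + 1, by rw [h]; push_cast; rfl⟩
  obtain ⟨m, hm⟩ := r1
  obtain ⟨n, hn⟩ := r2
  exact ⟨(m, n), by ext i; fin_cases i <;> simp [hm, hn]⟩

theorem exists_eq_latIso_of_image_stdSquare {e : Plane ≃ᵢ Plane} {c : ℤ × ℤ}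
    (he : e '' stdSquare = cell c) : ∃ w t, e = latIso w t := by
  have hmem : ∀ p ∈ stdSquare, e p ∈ cell c := fun p hp => he ▸ Set.mem_image_of_mem e hp
  refine exists_eq_latIso
    (isLatticePoint_of_dist_sq (hmem 0 ?_) (hmem !₂[1, 1] ?_) ?_)
    (isLatticePoint_of_dist_sq (hmem !₂[1, 0] ?_) (hmem !₂[0, 1] ?_) ?_)
  any_goals simp [stdSquare, Fin.forall_fin_two]
  all_goals rw [e.isometry.dist_eq, dist_sq_plane]; norm_num

theorem mem_stdSide {p : Plane} : p ∈ stdSide ↔ (0 ≤ p 0 ∧ p 0 ≤ 1) ∧ p 1 = 0 := by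
  simp only [stdSide, stdSquare, Set.mem_ofPred_eq, Fin.forall_fin_two, Set.mem_Icc]
  constructor
  · rintro ⟨⟨h1, h2⟩, h3⟩; exact ⟨h1, h3⟩
  · rintro ⟨h1, h3⟩; exact ⟨⟨h1, by rw [h3], by rw [h3]; norm_num⟩, h3⟩

theorem isLatticePoint_of_stdSide {p q : Plane} (hp : p ∈ stdSide) (hq : q ∈ stdSide)
    (h : dist p q ^ 2 = 1) : IsLatticePoint p := by
  rw [mem_stdSide] at hp hq
  rw [dist_sq_plane, hp.2, hq.2] at h
  obtain ⟨⟨h1, h2⟩, h3⟩ := hp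
  obtain ⟨⟨g1, g2⟩, g3⟩ := hq
  rcases sq_eq_one_iff.mp (show (p 0 - q 0) ^ 2 = 1 by linarith) with h | h
  · refine ⟨(1, 0), ?_⟩
    ext i; fin_cases i <;> simp [h3]; linarith
  · refine ⟨(0, 0), ?_⟩
    ext i; fin_cases i <;> simp [h3]; linarith

theorem exists_eq_latIso_of_image_stdSide {e : Plane ≃ᵢ Plane}
    (he : e '' stdSide = stdSide) : ∃ w t, e = latIso w t := by
  have hmem : ∀ p ∈ stdSide, e p ∈ stdSide := fun p hp => by
    rw [← he]; exact Set.mem_image_of_mem e hp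
  have m0 : (0 : Plane) ∈ stdSide := by simp [mem_stdSide]
  have m1 : (!₂[1, 0] : Plane) ∈ stdSide := by simp [mem_stdSide]
  refine exists_eq_latIso
    (isLatticePoint_of_stdSide (hmem _ m0) (hmem _ m1) ?_)
    (isLatticePoint_of_stdSide (hmem _ m1) (hmem _ m0) ?_)
  all_goals rw [e.isometry.dist_eq, dist_sq_plane]; simp

theorem act_step_three (w : Bool × Bool × Bool) (t : ℤ × ℤ) :
    ∃ d, act w t (step 3) = t + step d := by
  obtain ⟨s, a, b⟩ := w
  cases s
  · cases b
    · exact ⟨3, by cases a <;> ext <;> simp [act, step, sgn] <;> ring⟩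
    · exact ⟨2, by cases a <;> ext <;> simp [act, step, sgn] <;> ring⟩
  · cases a
    · exact ⟨1, by cases b <;> ext <;> simp [act, step, sgn] <;> ring⟩
    · exact ⟨0, by cases b <;> ext <;> simp [act, step, sgn] <;> ring⟩

theorem stdSide_ne_stdSquare : stdSide ≠ stdSquare := by
  intro h
  have : (!₂[1, 1] : Plane) ∈ stdSide := by
    rw [h]; simp [stdSquare, Fin.forall_fin_two]
  simp [mem_stdSide] at this

theorem act_zero_cell (w : Bool × Bool × Bool) (t : ℤ × ℤ) : act w t (0, 0) = t := by
  simp [act]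

/-- Let `e` and `e'` place the standard square on the two squares, both taking the standard side to
the common side. Then `e'` followed by the inverse of `e` preserves the standard side, so it is a
lattice isometry, and pulling `B` back by `e` gives a cell containing that side: the standard square
or the cell below it. -/
theorem ShareSide.exists_eq_cell {c : ℤ × ℤ} {B : Set Plane} (h : ShareSide (cell c) B) :
    ∃ d, B = cell (c + step d) := by
  obtain ⟨⟨e, he, heS⟩, ⟨e', he', heS'⟩⟩ := h
  obtain ⟨w, t, hw⟩ := exists_eq_latIso_of_image_stdSquare he
  have hside : (e'.trans e.symm) '' stdSide = stdSide := by
    change (e.symm ∘ e') '' stdSide = stdSide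
    rw [Set.image_comp, heS', ← heS, ← Set.image_comp]
    simp
  obtain ⟨w', t', hw'⟩ := exists_eq_latIso_of_image_stdSide hside
  have hsq : (e'.trans e.symm) '' stdSquare = cell t' := by
    rw [hw', ← cell_zero, latIso_image_cell, act_zero_cell]
  have hB : B = e '' cell t' := by
    rw [← hsq, ← he', ← Set.image_comp]
    congr 1; ext x : 1; simp
  have hsub : stdSide ⊆ cell t' := by
    rw [← hside, ← hsq]; exact Set.image_mono fun p hp => hp.1
  have m0 := hsub (show (0 : Plane) ∈ stdSide by simp [mem_stdSide])
  have m1 := hsub (show (!₂[1, 0] : Plane) ∈ stdSide by simp [mem_stdSide])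
  rw [mem_cell] at m0 m1
  simp at m0 m1
  obtain ⟨⟨h1, h2⟩, h3, h4⟩ := m0
  obtain ⟨⟨g1, g2⟩, g3, g4⟩ := m1
  have k2 : (0 : ℤ) ≤ t'.1 := by exact_mod_cast g2
  have k4 : -1 ≤ t'.2 := by exact_mod_cast (by linarith : (-1 : ℝ) ≤ t'.2)
  have ht1 : t'.1 = 0 := le_antisymm h1 k2
  rcases (show t'.2 = 0 ∨ t'.2 = -1 by omega) with ht2 | ht2
  -- Here `B` would coincide with `cell c`, and their intersection would be a whole square rather
  -- than a side.
  · exfalso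
    have ht : t' = (0, 0) := Prod.ext ht1 ht2
    rw [ht, cell_zero, he] at hB
    rw [hB, Set.inter_self, ← he] at heS
    exact stdSide_ne_stdSquare (e.injective.image_injective heS)
  · have ht : t' = step 3 := Prod.ext ht1 ht2
    have hct : c = t := by
      apply cell_injective
      rw [← he, hw, ← cell_zero, latIso_image_cell, act_zero_cell]
    obtain ⟨d, hd⟩ := act_step_three w t
    exact ⟨d, by rw [hB, ht, hw, latIso_image_cell, hd, hct]⟩

theorem stdSquare_inter_cell_step : stdSquare ∩ cell (step 3) = stdSide := by
  ext p
  rw [← cell_zero, Set.mem_inter_iff, mem_cell, mem_cell, mem_stdSide]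
  simp only [step, Int.cast_zero, Int.cast_neg, Int.cast_one]
  constructor
  · rintro ⟨⟨h1, h2⟩, h3, h4⟩
    exact ⟨⟨by linarith, by linarith⟩, by linarith⟩
  · rintro ⟨⟨h1, h2⟩, h3⟩
    rw [h3]
    norm_num; exact ⟨h1, h2⟩

theorem isSide_inter_cell (c : ℤ × ℤ) (d : Fin 4) :
    IsSide (cell c ∩ cell (c + step d)) (cell c) := by
  obtain ⟨w, hw⟩ : ∃ w, act w c (step 3) = c + step d := by
    obtain ⟨x, y⟩ := c
    fin_cases d
    · exact ⟨(true, true, false), by ext <;> simp [act, step, sgn] <;> ring⟩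
    · exact ⟨(true, false, false), by ext <;> simp [act, step, sgn] <;> ring⟩
    · exact ⟨(false, false, true), by ext <;> simp [act, step, sgn] <;> ring⟩
    · exact ⟨(false, false, false), by ext <;> simp [act, step, sgn] <;> ring⟩
  have h0 : latIso w c '' stdSquare = cell c := by
    rw [← cell_zero, latIso_image_cell, act_zero_cell]
  refine ⟨latIso w c, h0, ?_⟩
  rw [← stdSquare_inter_cell_step, Set.image_inter (latIso w c).injective, h0,
    latIso_image_cell, hw]

theorem exists_step_neg (d : Fin 4) : ∃ d', step d' = -step d := by
  revert d; decide

theorem shareSide_cell (c : ℤ × ℤ) (d : Fin 4) : ShareSide (cell c) (cell (c + step d)) := by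
  refine ⟨isSide_inter_cell c d, ?_⟩
  obtain ⟨d', hd'⟩ := exists_step_neg d
  have := isSide_inter_cell (c + step d) d'
  rwa [hd', add_neg_cancel_right, Set.inter_comm] at this

theorem stdSquare_inter_cell_neg : stdSquare ∩ cell (-1, -1) = {0} := by
  ext p
  rw [← cell_zero, Set.mem_inter_iff, mem_cell, mem_cell, Set.mem_singleton_iff]
  simp only [Int.cast_zero, Int.cast_neg, Int.cast_one]
  constructor
  · rintro ⟨⟨⟨h1, h2⟩, h3, h4⟩, ⟨h5, h6⟩, h7, h8⟩
    ext i; fin_cases i <;> simp <;> linarith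
  · rintro rfl
    norm_num

theorem isCorner_inter_cell (c : ℤ × ℤ) {x y : ℤ} (hx : x = 1 ∨ x = -1) (hy : y = 1 ∨ y = -1) :
    ∃ v, cell c ∩ cell (c + (x, y)) = {v} ∧ IsCorner v (cell c) := by
  obtain ⟨w, hw⟩ : ∃ w, act w c (-1, -1) = c + (x, y) := by
    rcases hx with rfl | rfl <;> rcases hy with rfl | rfl
    · exact ⟨(false, true, true), by ext <;> (simp [act, sgn]; ring)⟩
    · exact ⟨(false, true, false), by ext <;> (simp [act, sgn]; ring)⟩
    · exact ⟨(false, false, true), by ext <;> (simp [act, sgn]; ring)⟩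
    · exact ⟨(false, false, false), by ext <;> (simp [act, sgn]; ring)⟩
  have h0 : latIso w c '' stdSquare = cell c := by
    rw [← cell_zero, latIso_image_cell, act_zero_cell]
  refine ⟨latIso w c 0, ?_, latIso w c, h0, rfl⟩
  rw [← Set.image_singleton, ← stdSquare_inter_cell_neg,
    Set.image_inter (latIso w c).injective, h0, latIso_image_cell, hw]

theorem shareCorner_cell (c : ℤ × ℤ) {x y : ℤ} (hx : x = 1 ∨ x = -1) (hy : y = 1 ∨ y = -1) :
    ShareCorner (cell c) (cell (c + (x, y))) := by
  obtain ⟨v, hv, hv'⟩ := isCorner_inter_cell c hx hy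
  obtain ⟨u, hu, hu'⟩ := isCorner_inter_cell (c + (x, y)) (x := -x) (y := -y) (by omega) (by omega)
  have : c + (x, y) + (-x, -y) = c := by ext <;> simp
  rw [this, Set.inter_comm, hv, Set.singleton_eq_singleton_iff] at hu
  exact ⟨v, hv, hv', hu ▸ hu'⟩

theorem joinedAlongEdges_cells (C : Set (ℤ × ℤ)) : JoinedAlongEdges (cell '' C) := by
  rintro _ ⟨c, -, rfl⟩ _ ⟨c', -, rfl⟩ hne
  obtain ⟨⟨x, y⟩, rfl⟩ : ∃ m, c' = c + m := ⟨c' - c, by abel⟩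
  by_cases hd : -1 ≤ x ∧ x ≤ 1 ∧ -1 ≤ y ∧ y ≤ 1
  · right
    obtain ⟨h1, h2, h3, h4⟩ := hd
    by_cases hx : x = 0
    · left
      subst hx
      rcases (show y = 0 ∨ y = 1 ∨ y = -1 by omega) with rfl | rfl | rfl
      · exact absurd (by simp [Prod.mk_zero_zero]) hne
      · exact shareSide_cell c 2
      · exact shareSide_cell c 3
    · by_cases hy : y = 0
      · left
        subst hy
        rcases (show x = 1 ∨ x = -1 by omega) with rfl | rfl
        · exact shareSide_cell c 0
        · exact shareSide_cell c 1
      · exact Or.inr (shareCorner_cell c (by omega) (by omega))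
  · left
    rw [Set.eq_empty_iff_forall_notMem]
    rintro p ⟨hp, hq⟩
    rw [mem_cell] at hp hq
    simp only [Prod.fst_add, Prod.snd_add, Int.cast_add] at hq
    obtain ⟨⟨h1, h2⟩, h3, h4⟩ := hp
    obtain ⟨⟨g1, g2⟩, g3, g4⟩ := hq
    refine hd ⟨?_, ?_, ?_, ?_⟩
    · exact_mod_cast (by linarith : (-1 : ℝ) ≤ x)
    · exact_mod_cast (by linarith : (x : ℝ) ≤ 1)
    · exact_mod_cast (by linarith : (-1 : ℝ) ≤ y)
    · exact_mod_cast (by linarith : (y : ℝ) ≤ 1)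

/-! ### Frames and rolling -/

/-- The coordinates of the signed coordinate direction `r`. -/
def vec (r : ℤ) (k : Fin 3) : ℤ :=
  if r = (k : ℕ) + 1 then 1 else if r = -((k : ℕ) + 1) then -1 else 0

theorem vec_neg (r : ℤ) (k : Fin 3) : vec (-r) k = -vec r k := by
  unfold vec
  split_ifs <;> first | rfl | omega

/-- The affine map of space that fixes the centre of the cube and takes the coordinate
directions to the members of the frame. -/
noncomputable def frameMap (r : Frame) (x : Space) : Space :=
  WithLp.toLp 2 fun k => 1 / 2 + (x 0 - 1 / 2) * vec r.1 k + (x 1 - 1 / 2) * vec r.2.1 k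
    + (x 2 - 1 / 2) * vec r.2.2 k

/-- The quarter turn of the cube about the side that the face shares with its neighbour. -/
noncomputable def rollIso : Fin 4 → Space ≃ᵢ Space
  | 0 => sgnIso (Equiv.swap 0 2) ![true, false, false] 0
  | 1 => sgnIso (Equiv.swap 0 2) ![false, false, true] 0
  | 2 => sgnIso (Equiv.swap 1 2) ![false, true, false] 0
  | 3 => sgnIso (Equiv.swap 1 2) ![false, false, true] 0

theorem cubeSym_rollIso (d : Fin 4) : CubeSym (rollIso d) := by
  fin_cases d <;> exact cubeSym_sgnIso _ _

theorem rollIso_apply (d : Fin 4) (x : Space) : rollIso d x =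
    (![!₂[1 - x 2, x 1, x 0], !₂[x 2, x 1, 1 - x 0], !₂[x 0, 1 - x 2, x 1],
      !₂[x 0, x 2, 1 - x 1]] : Fin 4 → Space) d := by
  have h1 : (Equiv.swap 0 2 : Equiv.Perm (Fin 3)) 1 = 1 := by decide
  have h2 : (Equiv.swap 1 2 : Equiv.Perm (Fin 3)) 0 = 0 := by decide
  ext k
  fin_cases d <;> fin_cases k <;> simp [rollIso, sgn, h1, h2] <;> ring

/-- Rolling is precomposition with a fixed symmetry of the cube, so frames obtained by rolling again
come from symmetries. -/
theorem frameMap_roll (d : Fin 4) (r : Frame) (x : Space) :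
    frameMap (roll d r) x = frameMap r (rollIso d x) := by
  rw [rollIso_apply]
  obtain ⟨u, v, w⟩ := r
  ext k
  fin_cases d <;> simp [frameMap, roll, vec_neg] <;> ring

/-- The frames that come from symmetries of the cube. -/
def CubeFrame (r : Frame) : Prop :=
  ∃ T : Space ≃ᵢ Space, CubeSym T ∧ ∀ x, T x = frameMap r x

theorem cubeFrame_std : CubeFrame (1, 2, 3) := by
  refine ⟨IsometryEquiv.refl _, cubeSym_refl, fun x => ?_⟩
  ext k
  change x k = _
  fin_cases k <;> simp [frameMap, vec]

theorem CubeFrame.roll {r : Frame} (h : CubeFrame r) (d : Fin 4) :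
    CubeFrame (CubeUnfolding.roll d r) := by
  obtain ⟨T, hT, hr⟩ := h
  exact ⟨(rollIso d).trans T, (cubeSym_rollIso d).trans hT, fun x => by
    rw [frameMap_roll, ← hr]; rfl⟩

/-- The standard placement of the lattice cell `c` on the bottom face of the cube. -/
noncomputable def flat (c : ℤ × ℤ) (p : Plane) : Space := !₂[p 0 - c.1, p 1 - c.2, 0]

theorem dist_flat (c : ℤ × ℤ) (p q : Plane) : dist (flat c p) (flat c q) = dist p q := by
  rw [← sq_eq_sq₀ dist_nonneg dist_nonneg, dist_sq_space, dist_sq_plane]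
  simp [flat]

/-- The bottom face of the cube. -/
def bottomFace : Set Space := {x | x ∈ solidCube ∧ x 2 = 0}

theorem bottomFace_mem : bottomFace ∈ cubeFaces := ⟨2, 0, Or.inl rfl, rfl⟩

theorem flat_image_cell (c : ℤ × ℤ) : flat c '' cell c = bottomFace := by
  ext x
  simp only [Set.mem_image, mem_cell, bottomFace, solidCube, Set.mem_ofPred_eq, Set.mem_Icc,
    Fin.forall_fin_succ]
  constructor
  · rintro ⟨p, ⟨⟨h1, h2⟩, h3, h4⟩, rfl⟩
    simp [flat]
    refine ⟨⟨h1, by linarith⟩, h3, by linarith⟩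
  · rintro ⟨⟨⟨h1, h2⟩, ⟨h3, h4⟩, -⟩, h5⟩
    simp at h1 h2 h3 h4
    refine ⟨!₂[x 0 + c.1, x 1 + c.2], ?_, ?_⟩
    · simp
      exact ⟨⟨h1, by linarith⟩, h3, by linarith⟩
    · ext k; fin_cases k <;> simp [flat, h5]

/-- The placement of the lattice cell `c` on the cube with frame `r`. -/
noncomputable def place (r : Frame) (c : ℤ × ℤ) (p : Plane) : Space := frameMap r (flat c p)

theorem CubeFrame.dist_place {r : Frame} (h : CubeFrame r) (c : ℤ × ℤ) (p q : Plane) :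
    dist (place r c p) (place r c q) = dist p q := by
  obtain ⟨T, -, hr⟩ := h
  rw [place, place, ← hr, ← hr, T.isometry.dist_eq, dist_flat]

theorem CubeFrame.place_image_cell_mem {r : Frame} (h : CubeFrame r) (c : ℤ × ℤ) :
    place r c '' cell c ∈ cubeFaces := by
  obtain ⟨T, hT, hr⟩ := h
  have : place r c '' cell c = T '' (flat c '' cell c) := by
    rw [Set.image_image]
    exact Set.image_congr fun p _ => (hr _).symm
  rw [this, flat_image_cell]
  exact hT.1 _ bottomFace_mem

/-- The centre of the face of the cube with inward normal `r`. -/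
noncomputable def faceCenter (r : ℤ) : Space := WithLp.toLp 2 fun k => 1 / 2 - 1 / 2 * (vec r k : ℝ)

/-- This point depends only on the third entry of the frame, so that integer identifies the face
covered. -/
theorem faceCenter_mem_place_image (r : Frame) (c : ℤ × ℤ) :
    faceCenter r.2.2 ∈ place r c '' cell c := by
  refine ⟨!₂[c.1 + 1 / 2, c.2 + 1 / 2], ?_, ?_⟩
  · rw [mem_cell]; simp; norm_num
  · ext k
    simp [place, frameMap, flat, faceCenter]
    ring

/-- Only one coordinate of a face centre differs from `1/2`. For `r` outside `±1, ±2, ±3` the point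
is the centre of the cube, which is on no face, so `r` may be arbitrary. -/
theorem eq_of_faceCenter_mem {r : ℤ} {i : Fin 3} {c : ℝ} (hc : c = 0 ∨ c = 1)
    (h : faceCenter r i = c) :
    c = 0 ∧ r = (i : ℕ) + 1 ∨ c = 1 ∧ r = -((i : ℕ) + 1) := by
  simp only [faceCenter, vec] at h
  rcases hc with rfl | rfl
  · left
    refine ⟨rfl, ?_⟩
    by_contra hne
    rw [if_neg hne] at h
    split_ifs at h <;> norm_num at h
  · right
    refine ⟨rfl, ?_⟩
    by_contra hne
    rw [if_neg hne] at h
    split_ifs at h <;> norm_num at h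

theorem face_eq_of_faceCenter_mem {r : ℤ} {F G : Set Space} (hF : F ∈ cubeFaces)
    (hG : G ∈ cubeFaces) (h : faceCenter r ∈ F) (h' : faceCenter r ∈ G) : F = G := by
  obtain ⟨i, c, hc, rfl⟩ := hF
  obtain ⟨j, c', hc', rfl⟩ := hG
  have h1 := eq_of_faceCenter_mem hc h.2
  have h2 := eq_of_faceCenter_mem hc' h'.2
  rcases h1 with ⟨rfl, h1⟩ | ⟨rfl, h1⟩ <;> rcases h2 with ⟨rfl, h2⟩ | ⟨rfl, h2⟩
  · rw [show i = j by omega]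
  · omega
  · omega
  · rw [show i = j by omega]

theorem eq_of_faceCenter_mem_face {r s : ℤ} {F : Set Space} (hF : F ∈ cubeFaces)
    (h : faceCenter r ∈ F) (h' : faceCenter s ∈ F) : r = s := by
  obtain ⟨i, c, hc, rfl⟩ := hF
  have h1 := eq_of_faceCenter_mem hc h.2
  have h2 := eq_of_faceCenter_mem hc h'.2
  rcases h1 with ⟨rfl, h1⟩ | ⟨rfl, h1⟩ <;> rcases h2 with ⟨h, h2⟩ | ⟨h, h2⟩
  · omega
  · norm_num at h
  · norm_num at h
  · omega

/-! ### Folding is forced along common sides -/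

theorem mem_Icc_of_mem_face {F : Set Space} (hF : F ∈ cubeFaces) {x : Space} (hx : x ∈ F)
    (i : Fin 3) : 0 ≤ x i ∧ x i ≤ 1 := by
  obtain ⟨_, _, _, rfl⟩ := hF
  exact hx.1 i

/-- A face other than the bottom that contains the bottom edge `ab` is the vertical face over it. In
that face the corner next to `a` and diagonal to `b` is the one above `a`. -/
theorem hinge {G : Set Space} (hG : G ∈ cubeFaces) (hne : G ≠ bottomFace) {a b q : Space}
    (ha : a ∈ G) (hb : b ∈ G) (hq : q ∈ G) (ha2 : a 2 = 0) (hb2 : b 2 = 0)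
    (hab : a 0 = b 0 ∧ (a 1 - b 1) ^ 2 = 1 ∨ a 1 = b 1 ∧ (a 0 - b 0) ^ 2 = 1)
    (hqa : dist q a ^ 2 = 1) (hqb : dist q b ^ 2 = 2) : q = !₂[a 0, a 1, 1] := by
  have hq2 := mem_Icc_of_mem_face hG hq 2
  obtain ⟨i, c, -, rfl⟩ := hG
  rw [dist_sq_space, ha2] at hqa
  rw [dist_sq_space, hb2] at hqb
  have ha' := ha.2
  have hb' := hb.2
  have hq' := hq.2
  have key : ∀ {x y z : ℝ}, (x - y) ^ 2 = 1 → (z - y) ^ 2 - (z - x) ^ 2 = 1 → z = x := by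
    intro x y z h1 h2
    rcases sq_eq_one_iff.mp h1 with h | h <;> nlinarith
  have fin : q 0 = a 0 → q 1 = a 1 → q = !₂[a 0, a 1, 1] := by
    intro h0 h1
    rw [h0, h1] at hqa
    have : q 2 = 1 := by nlinarith
    ext k
    fin_cases k <;> simp [h0, h1, this]
  fin_cases i
  · simp only [Fin.zero_eta] at ha' hb' hq'
    rcases hab with ⟨h0, h1⟩ | ⟨-, h0⟩
    · refine fin (hq'.trans ha'.symm) (key h1 ?_)
      rw [hq', ha'] at hqa
      rw [hq', hb'] at hqb
      linarith
    · rw [ha', hb'] at h0; norm_num at h0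
  · simp only [Fin.mk_one] at ha' hb' hq'
    rcases hab with ⟨-, h1⟩ | ⟨h1, h0⟩
    · rw [ha', hb'] at h1; norm_num at h1
    · refine fin (key h0 ?_) (hq'.trans ha'.symm)
      rw [hq', ha'] at hqa
      rw [hq', hb'] at hqb
      linarith
  · simp only [Fin.reduceFinMk] at ha'
    refine absurd ?_ hne
    rw [← ha', ha2]
    rfl

/-- The alternatives in `hcase` are a vertical common side, from `p` to `p + (0, t)`, and a
horizontal one, from `p` to `p + (s, 0)`. `hinge` settles the third corner. -/
theorem eqOn_of_hinge {S : Set Plane} {h k : Plane → Space}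
    (hh : ∀ x ∈ S, ∀ y ∈ S, dist (h x) (h y) = dist x y)
    (hk : ∀ x ∈ S, ∀ y ∈ S, dist (k x) (k y) = dist x y)
    (hG : h '' S ∈ cubeFaces) (hne : h '' S ≠ bottomFace)
    {p : Plane} {s t : ℝ} (hs : s ^ 2 = 1) (ht : t ^ 2 = 1)
    (hp : p ∈ S) (hps : p + !₂[s, 0] ∈ S) (hpt : p + !₂[0, t] ∈ S)
    {x y : ℝ} (hpv : h p = !₂[x, y, 0])
    (hcase : h (p + !₂[0, t]) = !₂[x, y + t, 0] ∧ k p = !₂[x, y, 0] ∧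
        k (p + !₂[0, t]) = !₂[x, y + t, 0] ∧ k (p + !₂[s, 0]) = !₂[x, y, 1] ∨
      h (p + !₂[s, 0]) = !₂[x + s, y, 0] ∧ k p = !₂[x, y, 0] ∧
        k (p + !₂[s, 0]) = !₂[x + s, y, 0] ∧ k (p + !₂[0, t]) = !₂[x, y, 1]) :
    Set.EqOn h k S := by
  have m0 := Set.mem_image_of_mem h hp
  have ms := Set.mem_image_of_mem h hps
  have mt := Set.mem_image_of_mem h hpt
  have d1 : dist (h (p + !₂[s, 0])) (h p) ^ 2 = 1 := by
    rw [hh _ hps _ hp, dist_sq_plane]; simp [hs]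
  have d2 : dist (h (p + !₂[0, t])) (h p) ^ 2 = 1 := by
    rw [hh _ hpt _ hp, dist_sq_plane]; simp [ht]
  have d3 : dist (h (p + !₂[s, 0])) (h (p + !₂[0, t])) ^ 2 = 2 := by
    rw [hh _ hps _ hpt, dist_sq_plane]; simp [hs, ht]; norm_num
  rcases hcase with ⟨h1, k0, k1, k2⟩ | ⟨h1, k0, k1, k2⟩
  · refine eqOn_of_isometric hh hk hs ht hp hps hpt (hpv.trans k0.symm) ?_ (h1.trans k1.symm)
    rw [hinge hG hne m0 mt ms (by simp [hpv]) (by simp [h1])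
      (Or.inl ⟨by simp [hpv, h1], by simp [hpv, h1, ht]⟩) d1 d3, k2, hpv]
    rfl
  · refine eqOn_of_isometric hh hk hs ht hp hps hpt (hpv.trans k0.symm) (h1.trans k1.symm) ?_
    rw [dist_comm] at d3
    rw [hinge hG hne m0 ms mt (by simp [hpv]) (by simp [h1])
      (Or.inr ⟨by simp [hpv, h1], by simp [hpv, h1, hs]⟩) d2 d3, k2, hpv]
    rfl

theorem eqOn_rollIso_flat {h : Plane → Space} {c : ℤ × ℤ} {d : Fin 4}
    (hh : ∀ x ∈ cell (c + step d), ∀ y ∈ cell (c + step d), dist (h x) (h y) = dist x y)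
    (hG : h '' cell (c + step d) ∈ cubeFaces) (hne : h '' cell (c + step d) ≠ bottomFace)
    (hc : ∀ p ∈ cell c, h p = flat c p) :
    Set.EqOn h (fun p => rollIso d (flat (c + step d) p)) (cell (c + step d)) := by
  have hk : ∀ x ∈ cell (c + step d), ∀ y ∈ cell (c + step d),
      dist (rollIso d (flat (c + step d) x)) (rollIso d (flat (c + step d) y)) = dist x y :=
    fun x _ y _ => by rw [(rollIso d).isometry.dist_eq, dist_flat]
  have hv : ∀ {p : Plane} {x y : ℝ}, p ∈ cell c → p 0 - c.1 = x → p 1 - c.2 = y →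
      h p = !₂[x, y, 0] := by
    rintro p _ _ hp rfl rfl
    exact hc p hp
  have hd : d = 0 ∨ d = 1 ∨ d = 2 ∨ d = 3 := by omega
  -- In each direction `p` is an end of the common side, and the signs point from it to its two
  -- adjacent corners in the new cell.
  rcases hd with rfl | rfl | rfl | rfl
  · refine eqOn_of_hinge hh hk hG hne (p := !₂[c.1 + 1, c.2]) (s := 1) (t := 1) (by norm_num)
      (by norm_num) ?_ ?_ ?_ (x := 1) (y := 0) (hv ?_ ?_ ?_) (Or.inl ⟨hv ?_ ?_ ?_, ?_, ?_, ?_⟩)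
    all_goals simp [mem_cell, rollIso_apply, flat, step, add_assoc]
  · refine eqOn_of_hinge hh hk hG hne (p := !₂[c.1, c.2]) (s := -1) (t := 1) (by norm_num)
      (by norm_num) ?_ ?_ ?_ (x := 0) (y := 0) (hv ?_ ?_ ?_) (Or.inl ⟨hv ?_ ?_ ?_, ?_, ?_, ?_⟩)
    all_goals simp [mem_cell, rollIso_apply, flat, step, add_assoc]
  · refine eqOn_of_hinge hh hk hG hne (p := !₂[c.1, c.2 + 1]) (s := 1) (t := 1) (by norm_num)
      (by norm_num) ?_ ?_ ?_ (x := 0) (y := 1) (hv ?_ ?_ ?_) (Or.inr ⟨hv ?_ ?_ ?_, ?_, ?_, ?_⟩)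
    all_goals simp [mem_cell, rollIso_apply, flat, step, add_assoc]
  · refine eqOn_of_hinge hh hk hG hne (p := !₂[c.1, c.2]) (s := 1) (t := -1) (by norm_num)
      (by norm_num) ?_ ?_ ?_ (x := 0) (y := 0) (hv ?_ ?_ ?_) (Or.inr ⟨hv ?_ ?_ ?_, ?_, ?_, ?_⟩)
    all_goals simp [mem_cell, rollIso_apply, flat, step, add_assoc]

/-- The symmetry behind the frame is undone, which reduces to the case where `cell c` lies flat on
the bottom face. -/
theorem CubeFrame.eqOn_place_roll {f : Plane → Space} {r : Frame} (hr : CubeFrame r) {c : ℤ × ℤ}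
    {d : Fin 4}
    (hf : ∀ x ∈ cell (c + step d), ∀ y ∈ cell (c + step d), dist (f x) (f y) = dist x y)
    (hF : f '' cell (c + step d) ∈ cubeFaces) (hne : f '' cell (c + step d) ≠ f '' cell c)
    (hc : Set.EqOn f (place r c) (cell c)) :
    Set.EqOn f (place (CubeUnfolding.roll d r) (c + step d)) (cell (c + step d)) := by
  obtain ⟨T, hT, hTr⟩ := hr
  have h1 : ∀ p ∈ cell c, T.symm (f p) = flat c p := fun p hp => by
    rw [hc hp, place, ← hTr, T.symm_apply_apply]
  have himg : ∀ S : Set Plane, (fun p => T.symm (f p)) '' S = T.symm '' (f '' S) :=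
    fun S => (Set.image_image _ _ _).symm
  have h2 := eqOn_rollIso_flat (h := fun p => T.symm (f p)) (c := c) (d := d)
    (fun x hx y hy => by rw [T.symm.isometry.dist_eq, hf x hx y hy])
    (by rw [himg]; exact hT.2 _ hF)
    (by
      rw [himg, ← flat_image_cell c, ← Set.image_congr h1, himg]
      exact fun h => hne (T.symm.injective.image_injective h)) h1
  intro p hp
  rw [place, frameMap_roll, ← hTr, ← T.symm_apply_eq]
  exact h2 hp

/-! ### Normalizing the position of the first face -/

theorem exists_cubeSym_apply_two_eq_zero {F : Set Space} (hF : F ∈ cubeFaces) :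
    ∃ T, CubeSym T ∧ ∀ x ∈ F, T x 2 = 0 := by
  obtain ⟨i, c, hc, rfl⟩ := hF
  rcases hc with rfl | rfl
  · refine ⟨_, cubeSym_sgnIso (Equiv.swap i 2) (fun _ => false), fun x hx => ?_⟩
    simp [sgn, hx.2]
  · refine ⟨_, cubeSym_sgnIso (Equiv.swap i 2) (fun _ => true), fun x hx => ?_⟩
    simp [sgn, hx.2]; norm_num

/-- The vectors are orthogonal with nonnegative entries, so both products in their inner product
vanish. -/
theorem eq_basis_of_orthonormal_of_nonneg {x y x' y' : ℝ} (hx : 0 ≤ x) (hy : 0 ≤ y) (hx' : 0 ≤ x')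
    (hy' : 0 ≤ y') (e1 : x ^ 2 + y ^ 2 = 1) (e2 : x' ^ 2 + y' ^ 2 = 1)
    (e3 : (x - x') ^ 2 + (y - y') ^ 2 = 2) :
    (x = 1 ∧ y = 0 ∧ x' = 0 ∧ y' = 1) ∨ (x = 0 ∧ y = 1 ∧ x' = 1 ∧ y' = 0) := by
  have h : x * x' + y * y' = 0 := by linear_combination (e1 + e2 - e3) / 2
  have hone : ∀ {z : ℝ}, 0 ≤ z → z ^ 2 = 1 → z = 1 := fun h0 h1 =>
    (sq_eq_one_iff.mp h1).resolve_right (by linarith)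
  have hxx : x * x' = 0 := by linarith [mul_nonneg hx hx', mul_nonneg hy hy']
  rcases mul_eq_zero.mp hxx with rfl | rfl
  · right
    have : y = 1 := hone hy (by linear_combination e1)
    subst this
    have : y' = 0 := by linarith
    subst this
    exact ⟨rfl, rfl, hone hx' (by linear_combination e2), rfl⟩
  · left
    have : y' = 1 := hone hy' (by linear_combination e2)
    subst this
    have : y = 0 := by linarith
    subst this
    exact ⟨hone hx (by linear_combination e1), rfl, rfl, rfl⟩

/-- The symmetries of the cube, reflections included, act transitively on the choices of a face, a
corner of it and an ordering of the two edges there. -/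
theorem exists_cubeSym_eqOn_flat {f : Plane → Space}
    (hf : ∀ x ∈ cell (0, 0), ∀ y ∈ cell (0, 0), dist (f x) (f y) = dist x y)
    (hF : f '' cell (0, 0) ∈ cubeFaces) :
    ∃ T, CubeSym T ∧ ∀ p ∈ cell (0, 0), T (f p) = flat (0, 0) p := by
  have m00 : (0 : Plane) ∈ cell (0, 0) := by simp [mem_cell]
  have m10 : (0 : Plane) + !₂[1, 0] ∈ cell (0, 0) := by simp [mem_cell]
  have m01 : (0 : Plane) + !₂[0, 1] ∈ cell (0, 0) := by simp [mem_cell]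
  have m11 : (!₂[1, 1] : Plane) ∈ cell (0, 0) := by simp [mem_cell]
  have bound : ∀ T, CubeSym T → ∀ p ∈ cell (0, 0), ∀ i, 0 ≤ T (f p) i ∧ T (f p) i ≤ 1 :=
    fun T hT p hp => mem_Icc_of_mem_face (hT.1 _ hF) ⟨_, ⟨p, hp, rfl⟩, rfl⟩
  have hd : ∀ T : Space ≃ᵢ Space, ∀ p ∈ cell (0, 0), ∀ q ∈ cell (0, 0),
      dist (T (f p)) (T (f q)) = dist p q :=
    fun T p hp q hq => by rw [T.isometry.dist_eq, hf p hp q hq]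
  obtain ⟨T, hT, hT2⟩ := exists_cubeSym_apply_two_eq_zero hF
  replace hT2 : ∀ p ∈ cell (0, 0), T (f p) 2 = 0 := fun p hp => hT2 _ ⟨p, hp, rfl⟩
  -- Move the image of the corner to the origin.
  obtain ⟨T', hT', h2, h0, h1⟩ : ∃ T', CubeSym T' ∧ (∀ p ∈ cell (0, 0), T' (f p) 2 = 0) ∧
      T' (f 0) 0 = 0 ∧ T' (f 0) 1 = 0 := by
    have hdist : dist (T (f 0)) (T (f !₂[1, 1])) ^ 2 = 2 := by
      rw [hd T _ m00 _ m11, dist_sq_plane]; norm_num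
    rw [dist_sq_space, hT2 _ m00, hT2 _ m11] at hdist
    have key : ∀ {x y : ℝ}, 0 ≤ x ∧ x ≤ 1 → 0 ≤ y ∧ y ≤ 1 →
        (x - y) ^ 2 ≤ 1 ∧ ((x - y) ^ 2 = 1 → x = 0 ∨ x = 1) := by
      rintro x y ⟨h1, h2⟩ ⟨h3, h4⟩
      refine ⟨by nlinarith, fun h => ?_⟩
      rcases sq_eq_one_iff.mp h with h | h
      · exact Or.inr (by linarith)
      · exact Or.inl (by linarith)
    have k0 := key (bound T hT _ m00 0) (bound T hT _ m11 0)
    have k1 := key (bound T hT _ m00 1) (bound T hT _ m11 1)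
    have e0 := k0.2 (by linarith [k0.1, k1.1])
    have e1 := k1.2 (by linarith [k0.1, k1.1])
    have b0 : ∃ b : Bool, (sgn b : ℝ) * (T (f 0) 0 - 1 / 2) + 1 / 2 = 0 := by
      rcases e0 with e | e
      · exact ⟨false, by rw [e]; norm_num [sgn]⟩
      · exact ⟨true, by rw [e]; norm_num [sgn]⟩
    have b1 : ∃ b : Bool, (sgn b : ℝ) * (T (f 0) 1 - 1 / 2) + 1 / 2 = 0 := by
      rcases e1 with e | e
      · exact ⟨false, by rw [e]; norm_num [sgn]⟩
      · exact ⟨true, by rw [e]; norm_num [sgn]⟩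
    obtain ⟨a, ha⟩ := b0
    obtain ⟨b, hb⟩ := b1
    refine ⟨T.trans (sgnIso 1 ![a, b, false] 0), hT.trans (cubeSym_sgnIso _ _), fun p hp => ?_,
      ?_, ?_⟩
    · change sgnIso 1 ![a, b, false] 0 (T (f p)) 2 = 0
      simp [sgn, hT2 p hp]
    · change sgnIso 1 ![a, b, false] 0 (T (f 0)) 0 = 0
      simpa using ha
    · change sgnIso 1 ![a, b, false] 0 (T (f 0)) 1 = 0
      simpa using hb
  -- The adjacent corners go to the adjacent corners, possibly interchanged.
  have d1 : dist (T' (f (0 + !₂[1, 0]))) (T' (f 0)) ^ 2 = 1 := by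
    rw [hd T' _ m10 _ m00, dist_sq_plane]; simp
  have d2 : dist (T' (f (0 + !₂[0, 1]))) (T' (f 0)) ^ 2 = 1 := by
    rw [hd T' _ m01 _ m00, dist_sq_plane]; simp
  have d3 : dist (T' (f (0 + !₂[1, 0]))) (T' (f (0 + !₂[0, 1]))) ^ 2 = 2 := by
    rw [hd T' _ m10 _ m01, dist_sq_plane]; simp; norm_num
  rw [dist_sq_space, h2 _ m00, h2 _ m10, h0, h1] at d1
  rw [dist_sq_space, h2 _ m00, h2 _ m01, h0, h1] at d2
  rw [dist_sq_space, h2 _ m10, h2 _ m01] at d3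
  have finish : ∀ T, CubeSym T → T (f 0) = !₂[0, 0, 0] →
      T (f (0 + !₂[1, 0])) = !₂[1, 0, 0] → T (f (0 + !₂[0, 1])) = !₂[0, 1, 0] →
      ∃ T, CubeSym T ∧ ∀ p ∈ cell (0, 0), T (f p) = flat (0, 0) p := by
    intro T hT g0 g1 g2
    refine ⟨T, hT, fun p hp => ?_⟩
    refine eqOn_of_isometric (f := fun p => T (f p)) (hd T) (fun x _ y _ => dist_flat _ x y)
      (p := 0) (s := 1) (t := 1) (by norm_num) (by norm_num) m00 m10 m01 ?_ ?_ ?_ hp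
    · rw [g0]; simp [flat]
    · rw [g1]; simp [flat]
    · rw [g2]; simp [flat]
  have p0 := bound T' hT' _ m10 0
  have p1 := bound T' hT' _ m10 1
  have q0 := bound T' hT' _ m01 0
  have q1 := bound T' hT' _ m01 1
  have g0 : T' (f 0) = !₂[0, 0, 0] := by
    ext k; fin_cases k <;> simp [h0, h1, h2 _ m00]
  rcases eq_basis_of_orthonormal_of_nonneg p0.1 p1.1 q0.1 q1.1 (by linear_combination d1)
    (by linear_combination d2) (by linear_combination d3) with ⟨x, y, x', y'⟩ | ⟨x, y, x', y'⟩
  · refine finish T' hT' g0 ?_ ?_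
    · ext k; fin_cases k <;> simp only [Fin.zero_eta, Fin.mk_one, Fin.reduceFinMk, x, y, h2 _ m10]
      <;> simp
    · ext k; fin_cases k <;> simp only [Fin.zero_eta, Fin.mk_one, Fin.reduceFinMk, x', y', h2 _ m01]
      <;> simp
  · have hs : ∀ z, (T'.trans (sgnIso (Equiv.swap 0 1) (fun _ => false) 0)) z
        = !₂[T' z 1, T' z 0, T' z 2] := by
      intro z
      change sgnIso (Equiv.swap 0 1) (fun _ => false) 0 (T' z) = _
      have h1 : (Equiv.swap 0 1 : Equiv.Perm (Fin 3)) 2 = 2 := by decide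
      ext k; fin_cases k <;> simp [sgn, h1]
    refine finish _ (hT'.trans (cubeSym_sgnIso (Equiv.swap 0 1) (fun _ => false))) ?_ ?_ ?_
    · rw [hs, g0]; simp
    · rw [hs, x, y, h2 _ m10]
    · rw [hs, x', y', h2 _ m01]

/-! ### The eleven nets are unfoldings -/

/-- The arrangement of the lattice squares of a list of cells. -/
def cellSet (L : List (ℤ × ℤ)) : Set (Set Plane) := cell '' {c | c ∈ L}

theorem netCells_nodup : ∀ a, (netCells a).Nodup := by decide

theorem netCells_length : ∀ a, (netCells a).length = 6 := by decide

theorem ncard_cellSet {L : List (ℤ × ℤ)} (hL : L.Nodup) : (cellSet L).ncard = L.length := by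
  rw [cellSet, Set.ncard_image_of_injective _ cell_injective,
    show {c | c ∈ L} = (L.toFinset : Set (ℤ × ℤ)) by ext; simp, Set.ncard_coe_finset,
    List.toFinset_card_of_nodup hL]

/-- Closure under tails makes each list of words a tree of paths from the empty word, which gives
connectedness. -/
theorem tail_mem_netWords : ∀ a, ∀ l ∈ netWords a, l.tail ∈ netWords a := by decide

theorem netFace_injective : ∀ a, ∀ l ∈ netWords a, ∀ l' ∈ netWords a,
    (endFrame l).2.2 = (endFrame l').2.2 → l = l' := by decide +kernel

theorem netFace_surjective : ∀ a, ∀ i : Fin 3,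
    (∃ l ∈ netWords a, (endFrame l).2.2 = (i : ℕ) + 1) ∧
    ∃ l ∈ netWords a, (endFrame l).2.2 = -((i : ℕ) + 1) := by decide +kernel

/-- Twice the `k`-th coordinate of the image of a lattice point under a placement, up to a
constant. -/
def placeInt (r : Frame) (c m : ℤ × ℤ) (k : Fin 3) : ℤ :=
  (2 * (m.1 - c.1) - 1) * vec r.1 k + (2 * (m.2 - c.2) - 1) * vec r.2.1 k - vec r.2.2 k

/-- The placements of two cells agree wherever the cells meet. -/
def Compatible (r : Frame) (c : ℤ × ℤ) (r' : Frame) (c' : ℤ × ℤ) : Prop :=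
  c.1 ≤ c'.1 + 1 → c'.1 ≤ c.1 + 1 → c.2 ≤ c'.2 + 1 → c'.2 ≤ c.2 + 1 → ∀ k : Fin 3,
    (c.1 = c'.1 → vec r.1 k = vec r'.1 k) ∧ (c.2 = c'.2 → vec r.2.1 k = vec r'.2.1 k) ∧
    placeInt r c (max c.1 c'.1, max c.2 c'.2) k = placeInt r' c' (max c.1 c'.1, max c.2 c'.2) k

instance (r : Frame) (c : ℤ × ℤ) (r' : Frame) (c' : ℤ × ℤ) : Decidable (Compatible r c r' c') :=
  inferInstanceAs (Decidable (_ → _))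

/-- Cells may also meet without being consecutive along a word; a single map on the region needs
agreement there too. -/
theorem netWords_compatible : ∀ a, ∀ l ∈ netWords a, ∀ l' ∈ netWords a,
    Compatible (endFrame l) (endCell l) (endFrame l') (endCell l') := by
  decide +kernel

theorem place_apply (r : Frame) (c : ℤ × ℤ) (p : Plane) (m : ℤ × ℤ) (k : Fin 3) :
    place r c p k = 1 / 2 + (placeInt r c m k : ℝ) / 2 + (p 0 - m.1) * vec r.1 k
      + (p 1 - m.2) * vec r.2.1 k := by
  simp [place, frameMap, flat, placeInt]
  ring

/-- Both placements are expanded about a common lattice corner. In a coordinate where the cells have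
equal position the frame entries agree; where they differ, the point has the coordinate of the
corner and the term vanishes. -/
theorem Compatible.place_eq {r r' : Frame} {c c' : ℤ × ℤ} (h : Compatible r c r' c') {p : Plane}
    (hp : p ∈ cell c) (hp' : p ∈ cell c') : place r c p = place r' c' p := by
  rw [mem_cell] at hp hp'
  obtain ⟨⟨h1, h2⟩, h3, h4⟩ := hp
  obtain ⟨⟨g1, g2⟩, g3, g4⟩ := hp'
  have b1 : c.1 ≤ c'.1 + 1 := by
    have : (c.1 : ℝ) ≤ c'.1 + 1 := h1.trans g2
    exact_mod_cast this
  have b2 : c'.1 ≤ c.1 + 1 := by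
    have : (c'.1 : ℝ) ≤ c.1 + 1 := g1.trans h2
    exact_mod_cast this
  have b3 : c.2 ≤ c'.2 + 1 := by
    have : (c.2 : ℝ) ≤ c'.2 + 1 := h3.trans g4
    exact_mod_cast this
  have b4 : c'.2 ≤ c.2 + 1 := by
    have : (c'.2 : ℝ) ≤ c.2 + 1 := g3.trans h4
    exact_mod_cast this
  have key : ∀ {a b : ℤ} {x : ℝ} {u v : ℤ}, (a : ℝ) ≤ x → x ≤ a + 1 → (b : ℝ) ≤ x → x ≤ b + 1 →
      (a = b → u = v) → (x - (max a b : ℤ)) * u = (x - (max a b : ℤ)) * v := by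
    intro a b x u v h1 h2 h3 h4 h
    rcases lt_trichotomy a b with hab | hab | hab
    · have : (a : ℝ) + 1 ≤ b := by exact_mod_cast hab
      rw [max_eq_right hab.le, show x = b by linarith]
      ring
    · rw [h hab]
    · have : (b : ℝ) + 1 ≤ a := by exact_mod_cast hab
      rw [max_eq_left hab.le, show x = a by linarith]
      ring
  ext k
  obtain ⟨e1, e2, e3⟩ := h b1 b2 b3 b4 k
  rw [place_apply r c p (max c.1 c'.1, max c.2 c'.2), place_apply r' c' p
    (max c.1 c'.1, max c.2 c'.2), e3, key h1 h2 g1 g2 e1, key h3 h4 g3 g4 e2]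

theorem cubeFrame_endFrame : ∀ l, CubeFrame (endFrame l)
  | [] => cubeFrame_std
  | d :: l => (cubeFrame_endFrame l).roll d

theorem exists_netFold (a : Fin 11) : ∃ f : Plane → Space, ∀ l ∈ netWords a,
    Set.EqOn f (place (endFrame l) (endCell l)) (cell (endCell l)) := by
  classical
  refine ⟨fun p => if h : ∃ l ∈ netWords a, p ∈ cell (endCell l) then
    place (endFrame h.choose) (endCell h.choose) p else 0, fun l hl p hp => ?_⟩
  have h : ∃ l ∈ netWords a, p ∈ cell (endCell l) := ⟨l, hl, hp⟩
  simp only [dif_pos h]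
  exact (netWords_compatible a _ h.choose_spec.1 l hl).place_eq h.choose_spec.2 hp

theorem cellSet_netCells (a : Fin 11) {Q : Set Plane} :
    Q ∈ cellSet (netCells a) ↔ ∃ l ∈ netWords a, cell (endCell l) = Q := by
  simp [cellSet, netCells_eq]

theorem foldsUpIntoCube_net (a : Fin 11) : FoldsUpIntoCube (cellSet (netCells a)) := by
  obtain ⟨f, hf⟩ := exists_netFold a
  have himg : ∀ l ∈ netWords a,
      f '' cell (endCell l) = place (endFrame l) (endCell l) '' cell (endCell l) :=
    fun l hl => Set.image_congr (hf l hl)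
  have hface : ∀ l ∈ netWords a, f '' cell (endCell l) ∈ cubeFaces := fun l hl => by
    rw [himg l hl]; exact (cubeFrame_endFrame l).place_image_cell_mem _
  have hcenter : ∀ l ∈ netWords a, faceCenter (endFrame l).2.2 ∈ f '' cell (endCell l) :=
    fun l hl => by rw [himg l hl]; exact faceCenter_mem_place_image _ _
  refine ⟨f, ?_, ?_, ?_, ?_⟩
  · intro Q hQ x hx y hy
    obtain ⟨l, hl, rfl⟩ := (cellSet_netCells a).1 hQ
    rw [hf l hl hx, hf l hl hy, (cubeFrame_endFrame l).dist_place]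
  · intro Q hQ
    obtain ⟨l, hl, rfl⟩ := (cellSet_netCells a).1 hQ
    exact hface l hl
  · intro Q hQ Q' hQ' h
    obtain ⟨l, hl, rfl⟩ := (cellSet_netCells a).1 hQ
    obtain ⟨l', hl', rfl⟩ := (cellSet_netCells a).1 hQ'
    have hc := hcenter l hl
    rw [show f '' cell (endCell l) = f '' cell (endCell l') from h] at hc
    rw [netFace_injective a l hl l' hl'
      (eq_of_faceCenter_mem_face (hface l' hl') hc (hcenter l' hl'))]
  · intro F hF
    obtain ⟨l, hl, hlF⟩ : ∃ l ∈ netWords a, faceCenter (endFrame l).2.2 ∈ F := by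
      obtain ⟨i, c, hc, rfl⟩ := hF
      have hcube : ∀ r, faceCenter r ∈ solidCube := fun r k => by
        simp only [faceCenter, vec]
        split_ifs <;> norm_num
      rcases hc with rfl | rfl
      · obtain ⟨l, hl, h⟩ := (netFace_surjective a i).1
        exact ⟨l, hl, hcube _, by simp [faceCenter, h, vec]⟩
      · obtain ⟨l, hl, h⟩ := (netFace_surjective a i).2
        refine ⟨l, hl, hcube _, ?_⟩
        simp only [faceCenter, h, vec]
        rw [if_neg (by omega)]
        norm_num
    exact ⟨_, (cellSet_netCells a).2 ⟨l, hl, rfl⟩,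
      face_eq_of_faceCenter_mem (hface l hl) hF (hcenter l hl) hlF⟩

theorem edgeConnected_net (a : Fin 11) : EdgeConnected (cellSet (netCells a)) := by
  set U := cellSet (netCells a) with hU
  have hmem : ∀ l ∈ netWords a, cell (endCell l) ∈ U :=
    fun l hl => (cellSet_netCells a).2 ⟨l, hl, rfl⟩
  have hroot : ∀ l ∈ netWords a, Relation.ReflTransGen
      (fun A B => A ∈ U ∧ B ∈ U ∧ ShareSide A B) (cell (endCell [])) (cell (endCell l)) := by
    intro l
    induction l with
    | nil => exact fun _ => .refl
    | cons d l ih =>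
      intro hl
      have hl' := tail_mem_netWords a _ hl
      exact (ih hl').tail ⟨hmem _ hl', hmem _ hl, shareSide_cell _ d⟩
  have hsymm : Std.Symm fun A B => A ∈ U ∧ B ∈ U ∧ ShareSide A B := by
    constructor
    rintro A B ⟨hA, hB, h⟩
    refine ⟨hB, hA, ?_⟩
    rw [ShareSide, Set.inter_comm]
    exact ⟨h.2, h.1⟩
  intro Q hQ R hR
  obtain ⟨l, hl, rfl⟩ := (cellSet_netCells a).1 hQ
  obtain ⟨l', hl', rfl⟩ := (cellSet_netCells a).1 hR
  exact (Relation.ReflTransGen.stdSymm.symm _ _ (hroot l hl)).trans (hroot l' hl')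

theorem isUnfolding_net (a : Fin 11) : IsUnfolding (cellSet (netCells a)) where
  card := by rw [ncard_cellSet (netCells_nodup a), netCells_length]
  squares := by
    rintro _ ⟨c, -, rfl⟩
    exact isUnitSquare_cell c
  joined := joinedAlongEdges_cells _
  connected := edgeConnected_net a
  folds := foldsUpIntoCube_net a

/-! ### Isometric images of unfoldings -/

theorem image_trans (e g : Plane ≃ᵢ Plane) (S : Set Plane) : (e.trans g) '' S = g '' (e '' S) :=
  Set.image_comp g e S

theorem IsSide.image {S Q : Set Plane} (h : IsSide S Q) (g : Plane ≃ᵢ Plane) :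
    IsSide (g '' S) (g '' Q) := by
  obtain ⟨e, rfl, rfl⟩ := h
  exact ⟨e.trans g, image_trans _ _ _, image_trans _ _ _⟩

theorem ShareSide.image {Q R : Set Plane} (h : ShareSide Q R) (g : Plane ≃ᵢ Plane) :
    ShareSide (g '' Q) (g '' R) := by
  rw [ShareSide, ← Set.image_inter g.injective]
  exact ⟨h.1.image g, h.2.image g⟩

theorem IsCorner.image {v : Plane} {Q : Set Plane} (h : IsCorner v Q) (g : Plane ≃ᵢ Plane) :
    IsCorner (g v) (g '' Q) := by
  obtain ⟨e, rfl, rfl⟩ := h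
  exact ⟨e.trans g, image_trans _ _ _, rfl⟩

theorem ShareCorner.image {Q R : Set Plane} (h : ShareCorner Q R) (g : Plane ≃ᵢ Plane) :
    ShareCorner (g '' Q) (g '' R) := by
  obtain ⟨v, hv, h1, h2⟩ := h
  refine ⟨g v, ?_, h1.image g, h2.image g⟩
  rw [← Set.image_inter g.injective, hv, Set.image_singleton]

theorem IsUnfolding.image {U : Set (Set Plane)} (h : IsUnfolding U) (g : Plane ≃ᵢ Plane) :
    IsUnfolding ((fun Q => g '' Q) '' U) where
  card := by rw [Set.ncard_image_of_injective _ g.injective.image_injective, h.card]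
  squares := by
    rintro _ ⟨Q, hQ, rfl⟩
    obtain ⟨e, rfl⟩ := h.squares Q hQ
    exact ⟨e.trans g, image_trans _ _ _⟩
  joined := by
    rintro _ ⟨Q, hQ, rfl⟩ _ ⟨R, hR, rfl⟩ hne
    rcases h.joined Q hQ R hR (fun h => hne (by rw [h])) with h | h | h
    · left
      change g '' Q ∩ g '' R = ∅
      rw [← Set.image_inter g.injective, h, Set.image_empty]
    · exact Or.inr (Or.inl (h.image g))
    · exact Or.inr (Or.inr (h.image g))
  connected := by
    rintro _ ⟨Q, hQ, rfl⟩ _ ⟨R, hR, rfl⟩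
    refine Relation.ReflTransGen.lift (fun Q => g '' Q) ?_ _ _ (h.connected Q hQ R hR)
    rintro A B ⟨hA, hB, hAB⟩
    exact ⟨⟨A, hA, rfl⟩, ⟨B, hB, rfl⟩, hAB.image g⟩
  folds := by
    obtain ⟨f, hf, hbij⟩ := h.folds
    have himg : ∀ Q : Set Plane, (fun p => f (g.symm p)) '' (g '' Q) = f '' Q := fun Q => by
      rw [Set.image_image]; simp
    refine ⟨fun p => f (g.symm p), ?_, ?_, ?_, ?_⟩
    · rintro _ ⟨Q, hQ, rfl⟩ _ ⟨x, hx, rfl⟩ _ ⟨y, hy, rfl⟩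
      simp only [g.symm_apply_apply, g.isometry.dist_eq]
      exact hf Q hQ x hx y hy
    · rintro _ ⟨Q, hQ, rfl⟩
      simp only [himg]
      exact hbij.mapsTo hQ
    · rintro _ ⟨Q, hQ, rfl⟩ _ ⟨R, hR, rfl⟩ hQR
      simp only [himg] at hQR
      rw [hbij.injOn hQ hR hQR]
    · intro F hF
      obtain ⟨Q, hQ, rfl⟩ := hbij.surjOn hF
      exact ⟨_, ⟨Q, hQ, rfl⟩, himg Q⟩

/-! ### Every unfolding is congruent to one of the nets -/

theorem IsUnfolding.exists_cells {U : Set (Set Plane)} (h : IsUnfolding U)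
    (h0 : cell (0, 0) ∈ U) : ∃ C, U = cell '' C := by
  refine ⟨cell ⁻¹' U, ?_⟩
  rw [Set.image_preimage_eq_inter_range, eq_comm, Set.inter_eq_left]
  intro Q hQ
  induction h.connected _ h0 Q hQ with
  | refl => exact ⟨_, rfl⟩
  | tail _ hAB ih =>
    obtain ⟨c, rfl⟩ := ih hAB.1
    obtain ⟨d, rfl⟩ := hAB.2.2.exists_eq_cell
    exact ⟨_, rfl⟩

theorem latIso_image_cells (w : Bool × Bool × Bool) (t : ℤ × ℤ) (C : Set (ℤ × ℤ)) :
    (fun Q => latIso w t '' Q) '' (cell '' C) = cell '' (act w t '' C) := by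
  simp only [Set.image_image, latIso_image_cell]

theorem IsUnfolding.exists_image_eq_cells {U : Set (Set Plane)} (h : IsUnfolding U) :
    ∃ (g : Plane ≃ᵢ Plane) (C : Set (ℤ × ℤ)), (fun Q => g '' Q) '' U = cell '' C ∧
      (0, 0) ∈ C ∧ ∀ c ∈ C, LexNonneg c := by
  have hfin : U.Finite := Set.finite_of_ncard_ne_zero (by rw [h.card]; norm_num)
  obtain ⟨Q, hQ⟩ : U.Nonempty := Set.nonempty_of_ncard_ne_zero (by rw [h.card]; norm_num)
  obtain ⟨e, rfl⟩ := h.squares Q hQ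
  have hQ' : cell (0, 0) ∈ (fun Q => e.symm '' Q) '' U :=
    ⟨_, hQ, by simp [Set.image_image, cell_zero]⟩
  obtain ⟨C, hC⟩ := (h.image e.symm).exists_cells hQ'
  have hCfin : C.Finite := by
    refine Set.Finite.of_finite_image ?_ cell_injective.injOn
    rw [← hC]; exact hfin.image _
  rw [hC] at hQ'
  -- The lexicographically least cell is translated to the origin.
  obtain ⟨m, hm, hmin⟩ := Set.exists_min_image C toLex hCfin (Set.image_nonempty.mp ⟨_, hQ'⟩)
  refine ⟨e.symm.trans (latIso (false, false, false) (-m)), act (false, false, false) (-m) '' C,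
    ?_, ⟨m, hm, by simp [act, sgn]⟩, ?_⟩
  · rw [← latIso_image_cells, ← hC, Set.image_image]
    simp only [image_trans]
  · rintro _ ⟨c, hc, rfl⟩
    have := Prod.Lex.toLex_le_toLex.1 (hmin c hc)
    simp only [act, sgn, LexNonneg, Prod.fst_neg, Prod.snd_neg, Bool.false_eq_true, if_false]
    omega

theorem exists_exit {α : Type*} {r : α → α → Prop} {P : α → Prop} {a b : α}
    (h : Relation.ReflTransGen r a b) (ha : P a) (hb : ¬ P b) : ∃ x y, r x y ∧ P x ∧ ¬ P y := by
  by_contra! hc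
  induction h with
  | refl => exact hb ha
  | tail _ hxy ih => exact ih fun hx => hb (hc _ _ hxy hx)

/-- While cells remain outside the list, connectedness supplies a common side leading out of it. The
fold on the new cell is forced by rolling, and injectivity on faces makes its face new, which is the
test in `extensions`. -/
theorem IsUnfolding.exists_partialNet {C : Set (ℤ × ℤ)} (h : IsUnfolding (cell '' C))
    (h0 : (0, 0) ∈ C) (hlex : ∀ c ∈ C, LexNonneg c) :
    ∃ L ∈ partialNets 5, ∀ x ∈ L, x.1 ∈ C := by
  obtain ⟨f₀, hf₀, hbij⟩ := h.folds
  obtain ⟨T, hT, hT0⟩ := exists_cubeSym_eqOn_flat (hf₀ _ ⟨_, h0, rfl⟩) (hbij.mapsTo ⟨_, h0, rfl⟩)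
  set f : Plane → Space := fun p => T (f₀ p) with hfdef
  have himg : ∀ S : Set Plane, f '' S = T '' (f₀ '' S) := fun S => (Set.image_image _ _ _).symm
  have hf : ∀ c ∈ C, ∀ x ∈ cell c, ∀ y ∈ cell c, dist (f x) (f y) = dist x y :=
    fun c hc x hx y hy => by rw [hfdef, T.isometry.dist_eq, hf₀ _ ⟨c, hc, rfl⟩ x hx y hy]
  have hface : ∀ c ∈ C, f '' cell c ∈ cubeFaces := fun c hc => by
    rw [himg]; exact hT.1 _ (hbij.mapsTo ⟨c, hc, rfl⟩)
  have hinj : ∀ c ∈ C, ∀ c' ∈ C, f '' cell c = f '' cell c' → c = c' := fun c hc c' hc' e => by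
    rw [himg, himg] at e
    exact cell_injective (hbij.injOn ⟨c, hc, rfl⟩ ⟨c', hc', rfl⟩ (T.injective.image_injective e))
  have hcard : C.ncard = 6 := by
    rw [← h.card, Set.ncard_image_of_injective _ cell_injective]
  -- The induction also carries the length, to find an unused cell, and the fact that each recorded
  -- frame describes the fold on its cell.
  suffices ∀ k ≤ 5, ∃ L ∈ partialNets k, L.length = k + 1 ∧ ∀ x ∈ L, x.1 ∈ C ∧
      CubeFrame x.2 ∧ Set.EqOn f (place x.2 x.1) (cell x.1) by
    obtain ⟨L, hL, -, hLC⟩ := this 5 le_rfl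
    exact ⟨L, hL, fun x hx => (hLC x hx).1⟩
  intro k
  induction k with
  | zero =>
    refine fun _ => ⟨[((0, 0), (1, 2, 3))], by simp [partialNets], rfl, fun x hx => ?_⟩
    rw [List.mem_singleton] at hx
    subst hx
    refine ⟨h0, cubeFrame_std, fun p hp => ?_⟩
    change T (f₀ p) = frameMap _ _
    rw [hT0 p hp]
    ext k
    fin_cases k <;> simp [frameMap, vec]
  | succ k ih =>
    intro hk
    obtain ⟨L, hL, hlen, hgood⟩ := ih (by omega)
    obtain ⟨c, hc, hcL⟩ : ∃ c ∈ C, c ∉ L.map Prod.fst := by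
      by_contra! hsub
      have h1 : C ⊆ ((L.map Prod.fst).toFinset : Set (ℤ × ℤ)) := fun c hc => by
        simpa using hsub c hc
      have h2 := Set.ncard_le_ncard h1 (Finset.finite_toSet _)
      rw [hcard, Set.ncard_coe_finset] at h2
      have h3 := List.toFinset_card_le (L.map Prod.fst)
      rw [List.length_map] at h3
      omega
    obtain ⟨x₀, hx₀⟩ : ∃ x, x ∈ L := List.exists_mem_of_length_pos (by omega)
    obtain ⟨_, _, ⟨-, hB, hAB⟩, ⟨x, hx, rfl⟩, hBL⟩ :=
      exists_exit (P := fun Q => ∃ x ∈ L, cell x.1 = Q)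
        (h.connected _ ⟨_, (hgood x₀ hx₀).1, rfl⟩ _ ⟨c, hc, rfl⟩) ⟨x₀, hx₀, rfl⟩ (by
          rintro ⟨x, hx, hxc⟩
          exact hcL (List.mem_map.2 ⟨x, hx, cell_injective hxc⟩))
    obtain ⟨d, rfl⟩ := hAB.exists_eq_cell
    have hd : x.1 + step d ∈ C := cell_injective.mem_set_image.1 hB
    have hnew : ∀ z ∈ L, z.1 ≠ x.1 + step d := fun z hz hzd => hBL ⟨z, hz, by rw [hzd]⟩
    obtain ⟨hxC, hxF, hxE⟩ := hgood x hx
    have hE := hxF.eqOn_place_roll (hf _ hd) (hface _ hd)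
      (fun e => hnew x hx (hinj _ hxC _ hd e.symm)) hxE
    refine ⟨L.orderedInsert entryLE (x.1 + step d, roll d x.2), ?_, ?_, ?_⟩
    · rw [partialNets, List.mem_flatMap]
      refine ⟨L, List.mem_dedup.2 hL, ?_⟩
      rw [extensions, List.mem_flatMap]
      refine ⟨x, hx, ?_⟩
      rw [List.mem_flatMap]
      refine ⟨d, by fin_cases d <;> simp, ?_⟩
      have hfaces : ∀ z ∈ L, z.2.2.2 ≠ (roll d x.2).2.2 := fun z hz e => hnew z hz <| by
        obtain ⟨hzC, -, hzE⟩ := hgood z hz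
        refine hinj _ hzC _ hd (face_eq_of_faceCenter_mem (r := z.2.2.2) (hface _ hzC)
          (hface _ hd) ?_ ?_)
        · rw [Set.image_congr hzE]; exact faceCenter_mem_place_image _ _
        · rw [Set.image_congr hE, e]; exact faceCenter_mem_place_image _ _
      rw [if_pos ⟨hlex _ hd, hfaces⟩]
      exact List.mem_singleton_self _
    · rw [List.orderedInsert_length, hlen]
    · intro z hz
      rcases (List.mem_orderedInsert _).1 hz with rfl | hz
      · exact ⟨hd, hxF.roll d, hE⟩
      · exact hgood z hz

theorem IsUnfolding.exists_image_net {U : Set (Set Plane)} (h : IsUnfolding U) :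
    ∃ (a : Fin 11) (g : Plane ≃ᵢ Plane), (fun Q => g '' Q) '' cellSet (netCells a) = U := by
  obtain ⟨g, C, hC, h0, hlex⟩ := h.exists_image_eq_cells
  have hU := h.image g
  rw [hC] at hU
  obtain ⟨L, hL, hLC⟩ := hU.exists_partialNet h0 hlex
  obtain ⟨a, -, w, -, t, -, hact⟩ := exists_act_of_mem_partialNets L hL
  have hsub : (fun Q => latIso w t '' Q) '' cellSet (netCells a) ⊆ cell '' C := by
    rw [cellSet, latIso_image_cells]
    refine Set.image_mono ?_
    rintro _ ⟨c, hc, rfl⟩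
    obtain ⟨x, hx, hxc⟩ := List.mem_map.1 (hact c hc)
    exact hxc ▸ hLC x hx
  -- Both arrangements have six squares, so the inclusion is an equality; nothing need be known
  -- about repetitions in `L`.
  have heq := Set.eq_of_subset_of_ncard_le hsub
    (by rw [hU.card, ((isUnfolding_net a).image _).card])
    (Set.finite_of_ncard_ne_zero (by rw [hU.card]; norm_num))
  refine ⟨a, (latIso w t).trans g.symm, ?_⟩
  simp only [image_trans]
  rw [← Set.image_image (fun Q => g.symm '' Q), heq, ← hC, Set.image_image]
  simp [Set.image_image]

/-! ### Nets with congruent regions agree -/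

theorem spread_perm {L L' : List (ℤ × ℤ)} (h : L.Perm L') : spread L = spread L' := by
  unfold spread
  rw [(h.map _).sum_eq]
  congr 1
  refine List.map_congr_left fun c _ => ?_
  exact (h.map _).sum_eq

theorem spread_map_act (w : Bool × Bool × Bool) (t : ℤ × ℤ) (L : List (ℤ × ℤ)) :
    spread (L.map (act w t)) = spread L := by
  have h : ∀ c c' : ℤ × ℤ, (((act w t c).1 - (act w t c').1) ^ 2 +
      ((act w t c).2 - (act w t c').2) ^ 2) = (c.1 - c'.1) ^ 2 + (c.2 - c'.2) ^ 2 := by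
    intro c c'
    obtain ⟨s, a, b⟩ := w
    cases s <;> cases a <;> cases b <;> simp [act, sgn] <;> ring
  simp only [spread, List.map_map, Function.comp_def, h]

theorem act_injective (w : Bool × Bool × Bool) (t : ℤ × ℤ) : Function.Injective (act w t) := by
  intro c c' h
  have := congrArg cell h
  rw [← latIso_image_cell, ← latIso_image_cell] at this
  exact cell_injective ((latIso w t).injective.image_injective this)

/-- An injection between two sets of six cells is a bijection, and `spread` depends neither on the
order of the cells nor on the isometry. -/
theorem eq_of_act_mem {a b : Fin 11} {w : Bool × Bool × Bool} {t : ℤ × ℤ}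
    (h : ∀ c ∈ netCells a, act w t c ∈ netCells b) : a = b := by
  apply spread_netCells_injective
  change spread _ = spread _
  rw [← spread_map_act w t]
  refine spread_perm (List.Subperm.perm_of_length_le (List.subperm_of_subset
    ((netCells_nodup a).map (act_injective w t)) fun x hx => ?_) ?_)
  · obtain ⟨c, hc, rfl⟩ := List.mem_map.1 hx
    exact h c hc
  · rw [List.length_map, netCells_length, netCells_length]

theorem netCells_zero_mem : ∀ a, ((0 : ℤ), (0 : ℤ)) ∈ netCells a := by decide

theorem netCells_lexNonneg : ∀ a, ∀ c ∈ netCells a, LexNonneg c := by decide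

/-- The bound `p 0 < 1` forces a cell containing `p` into column 0, where normalization leaves only
nonnegative heights. Hence the region near the origin is confined to a quadrant. -/
theorem nonneg_of_mem_region {C : Set (ℤ × ℤ)} (hC : ∀ c ∈ C, LexNonneg c) {p : Plane}
    (hp : p ∈ ⋃₀ (cell '' C)) (h0 : p 0 < 1) : 0 ≤ p 0 ∧ 0 ≤ p 1 := by
  obtain ⟨_, ⟨c, hc, rfl⟩, hpc⟩ := hp
  rw [mem_cell] at hpc
  obtain ⟨⟨h1, h2⟩, h3, h4⟩ := hpc
  have k1 : c.1 < 1 := by exact_mod_cast (by linarith : (c.1 : ℝ) < 1)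
  have hl := hC c hc
  unfold LexNonneg at hl
  have k2 : (0 : ℝ) ≤ c.1 := by exact_mod_cast (by omega : 0 ≤ c.1)
  have k3 : (0 : ℝ) ≤ c.2 := by exact_mod_cast (by omega : 0 ≤ c.2)
  exact ⟨k2.trans h1, k3.trans h3⟩

/-- A point of an integral unit interval can be moved by `1/2` in one direction inside the
interval, and by some positive amount in both directions unless it is an integer. -/
theorem exists_sign_move {a : ℤ} {x : ℝ} (h1 : a ≤ x) (h2 : x ≤ a + 1) :
    (∃ s : ℝ, (s = 1 / 2 ∨ s = -(1 / 2)) ∧ a ≤ x + s ∧ x + s ≤ a + 1) ∧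
    ((∃ m : ℤ, x = m) ∨ ∃ s : ℝ, 0 < s ∧ s ≤ 1 / 2 ∧ a ≤ x - s ∧ x + s ≤ a + 1) := by
  constructor
  · rcases le_total x (a + 1 / 2) with h | h
    · exact ⟨1 / 2, Or.inl rfl, by linarith, by linarith⟩
    · exact ⟨-(1 / 2), Or.inr rfl, by linarith, by linarith⟩
  · rcases h1.eq_or_lt with h | h
    · exact Or.inl ⟨a, h.symm⟩
    rcases h2.eq_or_lt with h' | h'
    · exact Or.inl ⟨a + 1, by push_cast; exact h'⟩
    refine Or.inr ⟨min (x - a) (a + 1 - x) / 2, ?_, ?_, ?_, ?_⟩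
    · have : 0 < min (x - a) (a + 1 - x) := lt_min (by linarith) (by linarith)
      linarith
    · have := min_le_left (x - a) (a + 1 - x)
      linarith
    · have := min_le_left (x - a) (a + 1 - x)
      linarith
    · have := min_le_right (x - a) (a + 1 - x)
      linarith

theorem linearIsometry_sq_add_sq (A : Plane ≃ₗᵢ[ℝ] Plane) (v : Plane) :
    (A v) 0 ^ 2 + (A v) 1 ^ 2 = v 0 ^ 2 + v 1 ^ 2 := by
  have := A.norm_map v
  rw [EuclideanSpace.norm_eq, EuclideanSpace.norm_eq, Real.sqrt_inj (by positivity)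
    (by positivity)] at this
  simpa [Fin.sum_univ_two] using this

theorem linearIsometry_smul_apply (A : Plane ≃ₗᵢ[ℝ] Plane) (r : ℝ) (v : Plane) (i : Fin 2) :
    (A (r • v)) i = r * (A v) i := by
  rw [map_smul]; rfl

theorem eq_zero_of_smul_mem_quadrant {A : Plane ≃ₗᵢ[ℝ] Plane} {r : ℝ} (hr : 0 < r) {v : Plane}
    (h : ∀ i, 0 ≤ (A (r • v)) i) (h' : ∀ i, 0 ≤ (A ((-r) • v)) i) : v = 0 := by
  apply A.injective
  rw [map_zero]
  ext i
  have h1 := h i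
  have h2 := h' i
  rw [linearIsometry_smul_apply] at h1 h2
  have h3 : r * (A v) i = 0 := by linarith
  exact (mul_eq_zero.mp h3).resolve_left hr.ne'

/-- If all small moves from a point of a lattice square inside the square are taken by a linear
isometry into the first quadrant, then the point is a lattice point. -/
theorem isLatticePoint_of_quadrant {A : Plane ≃ₗᵢ[ℝ] Plane} {q : Plane} {c : ℤ × ℤ}
    (hq : q ∈ cell c)
    (hquad : ∀ v : Plane, v 0 ^ 2 + v 1 ^ 2 < 1 → q + v ∈ cell c → ∀ i, 0 ≤ (A v) i) :
    IsLatticePoint q := by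
  rw [mem_cell] at hq
  obtain ⟨⟨h1, h2⟩, h3, h4⟩ := hq
  have hm : ∃ m : ℤ, q 0 = m := by
    refine (exists_sign_move h1 h2).2.resolve_right ?_
    rintro ⟨r, hr, hr', hr1, hr2⟩
    have hsq : |r| < 1 := by rw [abs_lt]; constructor <;> linarith
    have := eq_zero_of_smul_mem_quadrant (A := A) hr (v := !₂[1, 0])
      (hquad _ (by simpa using hsq) (by
        rw [mem_cell]; simp; exact ⟨⟨by linarith, hr2⟩, h3, h4⟩))
      (hquad _ (by simpa using hsq) (by
        rw [mem_cell]; simp; exact ⟨⟨by linarith, by linarith⟩, h3, h4⟩))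
    simpa using congrArg (fun v : Plane => v 0) this
  have hn : ∃ m : ℤ, q 1 = m := by
    refine (exists_sign_move h3 h4).2.resolve_right ?_
    rintro ⟨r, hr, hr', hr1, hr2⟩
    have hsq : |r| < 1 := by rw [abs_lt]; constructor <;> linarith
    have := eq_zero_of_smul_mem_quadrant (A := A) hr (v := !₂[0, 1])
      (hquad _ (by simpa using hsq) (by
        rw [mem_cell]; simp; exact ⟨⟨h1, h2⟩, by linarith, hr2⟩))
      (hquad _ (by simpa using hsq) (by
        rw [mem_cell]; simp; exact ⟨⟨h1, h2⟩, by linarith, by linarith⟩))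
    simpa using congrArg (fun v : Plane => v 1) this
  obtain ⟨m, hm⟩ := hm
  obtain ⟨n, hn⟩ := hn
  exact ⟨(m, n), by ext i; fin_cases i <;> simp [hm, hn]⟩

/-- From `q`, half a unit can be moved inside the cell along each axis. These orthogonal moves go to
orthogonal vectors of the closed quadrant, which must lie along the axes. -/
theorem exists_lattice_preimage_of_quadrant {A : Plane ≃ₗᵢ[ℝ] Plane} {q : Plane} {c : ℤ × ℤ}
    (hq : q ∈ cell c)
    (hquad : ∀ v : Plane, v 0 ^ 2 + v 1 ^ 2 < 1 → q + v ∈ cell c → ∀ i, 0 ≤ (A v) i) :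
    ∃ u, IsLatticePoint u ∧ A u = !₂[1, 0] := by
  rw [mem_cell] at hq
  obtain ⟨⟨h1, h2⟩, h3, h4⟩ := hq
  obtain ⟨s, hs, hs1, hs2⟩ := (exists_sign_move h1 h2).1
  obtain ⟨t, ht, ht1, ht2⟩ := (exists_sign_move h3 h4).1
  have k0 := hquad (s • !₂[1, 0]) (by rcases hs with rfl | rfl <;> simp <;> norm_num) (by
    rw [mem_cell]; simp; exact ⟨⟨hs1, hs2⟩, h3, h4⟩)
  have k1 := hquad (t • !₂[0, 1]) (by rcases ht with rfl | rfl <;> simp <;> norm_num) (by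
    rw [mem_cell]; simp; exact ⟨⟨h1, h2⟩, ht1, ht2⟩)
  have n0 := linearIsometry_sq_add_sq A !₂[1, 0]
  have n1 := linearIsometry_sq_add_sq A !₂[0, 1]
  have n01 := linearIsometry_sq_add_sq A (!₂[1, 0] + !₂[0, 1])
  rw [map_add] at n01
  have hfinish : ∀ v : Plane, IsLatticePoint v → IsLatticePoint (-v) →
      (A v) 0 ^ 2 = 1 → (A v) 1 = 0 → ∃ u, IsLatticePoint u ∧ A u = !₂[1, 0] := by
    intro v hv hv' hv0 hv1
    rcases sq_eq_one_iff.mp hv0 with h | h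
    · exact ⟨v, hv, by ext i; fin_cases i <;> simp [h, hv1]⟩
    · refine ⟨-v, hv', ?_⟩
      rw [map_neg]
      ext i; fin_cases i <;> simp [h, hv1]
  have l0 : IsLatticePoint !₂[1, 0] := ⟨(1, 0), by simp⟩
  have l0' : IsLatticePoint (-!₂[1, 0]) := ⟨(-1, 0), by ext i; fin_cases i <;> simp⟩
  have l1 : IsLatticePoint !₂[0, 1] := ⟨(0, 1), by simp⟩
  have l1' : IsLatticePoint (-!₂[0, 1]) := ⟨(0, -1), by ext i; fin_cases i <;> simp⟩
  have hf0 := hfinish _ l0 l0'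
  have hf1 := hfinish _ l1 l1'
  have k00 := k0 0
  have k01 := k0 1
  have k10 := k1 0
  have k11 := k1 1
  rw [linearIsometry_smul_apply] at k00 k01 k10 k11
  simp only [PiLp.add_apply] at n01
  generalize (A !₂[1, 0]) 0 = x at *
  generalize (A !₂[1, 0]) 1 = y at *
  generalize (A !₂[0, 1]) 0 = x' at *
  generalize (A !₂[0, 1]) 1 = y' at *
  norm_num at n0 n1 n01
  have hst : s * t ≠ 0 := by
    rcases hs with rfl | rfl <;> rcases ht with rfl | rfl <;> norm_num
  -- Both products are nonnegative and, by orthogonality, sum to zero.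
  have p0 := mul_nonneg k00 k10
  have p1 := mul_nonneg k01 k11
  have hsum : s * x * (t * x') + s * y * (t * y') = 0 := by
    linear_combination s * t / 2 * (n01 - n0 - n1)
  have q0 : s * t * (x * x') = 0 := by linarith
  have q1 : s * t * (y * y') = 0 := by linarith
  have r0 := (mul_eq_zero.mp q0).resolve_left hst
  have r1 := (mul_eq_zero.mp q1).resolve_left hst
  rcases mul_eq_zero.mp r0 with h | h
  · rw [h] at n0
    have h' : y' = 0 := (mul_eq_zero.mp r1).resolve_left fun h' => by
      rw [h'] at n0; norm_num at n0
    exact hf1 (by rw [h'] at n1; linarith) h'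
  · rw [h] at n1
    have h' : y = 0 := (mul_eq_zero.mp r1).resolve_right fun h' => by
      rw [h'] at n1; norm_num at n1
    exact hf0 (by rw [h'] at n0; linarith) h'

theorem exists_eq_latIso_of_image_region {C C' : Set (ℤ × ℤ)} (h0 : (0, 0) ∈ C)
    (hC : ∀ c ∈ C, LexNonneg c) {g : Plane ≃ᵢ Plane}
    (hg : g '' ⋃₀ (cell '' C) = ⋃₀ (cell '' C')) : ∃ w t, g = latIso w t := by
  have hz : (0 : Plane) ∈ ⋃₀ (cell '' C) :=
    ⟨_, ⟨_, h0, rfl⟩, by simp [mem_cell]⟩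
  obtain ⟨_, ⟨c, hc, rfl⟩, hqc⟩ : g 0 ∈ ⋃₀ (cell '' C') := hg ▸ Set.mem_image_of_mem g hz
  -- `A` is the linear part of the inverse of `g`, based at the image of the origin.
  obtain ⟨A, hA⟩ : ∃ A : Plane ≃ₗᵢ[ℝ] Plane, ∀ v, g.symm (g 0 + v) = A v := by
    refine ⟨g.symm.toRealAffineIsometryEquiv.linearIsometryEquiv, fun v => ?_⟩
    have := g.symm.toRealAffineIsometryEquiv.map_vadd (g 0) v
    simpa [vadd_eq_add, add_comm] using this
  have hquad : ∀ v : Plane, v 0 ^ 2 + v 1 ^ 2 < 1 → g 0 + v ∈ cell c → ∀ i, 0 ≤ (A v) i := by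
    intro v hv hvc
    have hm : g 0 + v ∈ g '' ⋃₀ (cell '' C) := hg ▸ ⟨_, ⟨c, hc, rfl⟩, hvc⟩
    obtain ⟨p, hp, hpv⟩ := hm
    have hAv : A v = p := by rw [← hA, ← hpv, g.symm_apply_apply]
    have h1 := linearIsometry_sq_add_sq A v
    rw [hAv] at h1 ⊢
    rw [Fin.forall_fin_two]
    refine nonneg_of_mem_region hC hp ?_
    -- `p` has norm less than 1, hence first coordinate less than 1.
    nlinarith [sq_nonneg (p 1)]
  obtain ⟨u, ⟨m, rfl⟩, hu⟩ := exists_lattice_preimage_of_quadrant hqc hquad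
  have hlat := isLatticePoint_of_quadrant hqc hquad
  refine exists_eq_latIso hlat ?_
  obtain ⟨n, hn⟩ := hlat
  refine ⟨n + m, ?_⟩
  rw [← hu, ← hA, g.apply_symm_apply, hn]
  ext i; fin_cases i <;> simp

theorem net_eq_of_image_region {a b : Fin 11} {g : Plane ≃ᵢ Plane}
    (hg : g '' ⋃₀ cellSet (netCells a) = ⋃₀ cellSet (netCells b)) : a = b := by
  obtain ⟨w, t, rfl⟩ :=
    exists_eq_latIso_of_image_region (netCells_zero_mem a) (netCells_lexNonneg a) hg
  refine eq_of_act_mem (w := w) (t := t) fun c hc => ?_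
  refine cell_subset_sUnion_iff.1 (?_ : _ ⊆ ⋃₀ cellSet (netCells b))
  rw [← latIso_image_cell, ← hg]
  exact Set.image_mono (Set.subset_sUnion_of_mem ⟨c, hc, rfl⟩)

/-- The nets as unfoldings. -/
def net (a : Fin 11) : Unfolding := ⟨cellSet (netCells a), isUnfolding_net a⟩

theorem shapeCongruence_of_congruence {U V : Unfolding} (h : congruence.r U V) :
    shapeCongruence.r U V := by
  obtain ⟨g, hg⟩ := h
  refine ⟨g, ?_⟩
  rw [Unfolding.region, Unfolding.region, ← hg, Set.image_sUnion]

/-- For any relation between the two congruences, the finer one makes the nets exhaust the classes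
and the coarser one keeps them distinct. -/
theorem card_quotient_eq_eleven (s : Setoid Unfolding)
    (h1 : ∀ U V, congruence.r U V → s.r U V) (h2 : ∀ U V, s.r U V → shapeCongruence.r U V) :
    Nat.card (Quotient s) = 11 := by
  have hbij : Function.Bijective fun a => (Quotient.mk s (net a)) := by
    constructor
    · intro a b hab
      obtain ⟨g, hg⟩ := h2 _ _ (Quotient.exact hab)
      exact net_eq_of_image_region hg
    · intro q
      induction q using Quotient.inductionOn with
      | h U =>
        obtain ⟨a, g, hg⟩ := U.2.exists_image_net
        exact ⟨a, Quotient.sound (h1 _ _ ⟨g, hg⟩)⟩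
  rw [← Nat.card_eq_of_bijective _ hbij, Nat.card_eq_fintype_card, Fintype.card_fin]

end CubeUnfolding

theorem mainTheorem1 :
    Nat.card (Quotient CubeUnfolding.congruence) = 11 ∧
    Nat.card (Quotient CubeUnfolding.shapeCongruence) = 11 :=
  ⟨CubeUnfolding.card_quotient_eq_eleven _ (fun _ _ h => h)
      fun _ _ => CubeUnfolding.shapeCongruence_of_congruence,
    CubeUnfolding.card_quotient_eq_eleven _
      (fun _ _ => CubeUnfolding.shapeCongruence_of_congruence) fun _ _ h => h⟩
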